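/- **Setting.** Let $\Omega\subset\mathbb{R}^d$ be measurable with $0<|\Omega|<\infty$ and let $y\in L_2(\Omega)$ be a fixed function. Let $x_1,x_2,\ldots\in\Omega$ be fixed or random input locations whose empirical distribution functions converge (almost surely) to the distribution function of the uniform distribution on $\Omega$. For each $n$ let $\varphi=\varphi_n=(\varphi_{n,1},\ldots,\varphi_{n,p})^T$ be a vector of $p=p_n$ functions in $L_2(\Omega)$, with $p_n\to\infty$. Let $\beta^*=\beta^*_n$ be a minimizer over $\beta\in\mathbb{R}^p$ of the oracle risk $\int_\Omega (y(x)-\varphi(x)^T\beta)^2\,dx$, and assume $\beta^*\neq 0$ for all large $n$. Let $J_1,\ldots,J_q\subseteq\{1,\ldots,p\}$ be (possibly overlapping, $n$-dependent) groups that cover $\{1,\ldots,p\}$. Put $d_j=|J_j|$ and $\bar d=\max_j d_j$, let $\bar c$ be the largest number of groups that one index belongs to, and let $s$ be the number of nonzero entries of $\beta^*$. The responses are $y_i=y(x_i)=\varphi(x_i)^T\beta^*+B_i$ in the deterministic case, and $y_i=\varphi(x_i)^T\beta^*+B_i+\epsilon_i$ in the stochastic case, where $B_i=y(x_i)-\varphi(x_i)^T\beta^*$.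 Here the $\epsilon_i$ are i.i.d., independent of the inputs, with mean $0$, variance $\sigma^2>0$, and $\mathbb{P}(|\epsilon_i|>t)\le\exp(1-t^2/K)$ for all $t\ge 0$. The overlapping group lasso estimator is $\hat\beta=\big(\sum_{j:\,k\in J_j}\hat v_{jk}\big)_{k=1}^p$, where $\hat v$ is any minimizer over $v=(v_{jk})_{k\in J_j}$ of $$\frac1{2n}\sum_{i=1}^n\Big(y_i-\sum_{k=1}^p\varphi_{n,k}(x_i)\sum_{j:\,k\in J_j}v_{jk}\Big)^2+\lambda_n\sum_{j=1}^q\sqrt{d_j}\,\Big(\sum_{k\in J_j}v_{jk}^2\Big)^{1/2}.$$ Let $\Phi$ be the matrix with rows $\varphi(x_i)^T$, $i=1,\ldots,n$, let $C=\frac1n\Phi^T\Phi$, and let $\phi_{\min}(m)$ and $\phi_{\max}(m)$ be the minimum and maximum of $\beta^TC\beta/\beta^T\beta$ over $\beta\ne0$ with at most $m$ nonzero entries. **Assumptions.** There are constants $0<\kappa_{\min}\le\kappa_{\max}<\infty$ such that (almost surely) $\liminf_n\phi_{\min}\big(s\bar c\bar d\max\{\log n,\bar c\}\big)\ge\kappa_{\min}$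 and $\limsup_n\phi_{\max}\big((s\bar c+n)\bar d\big)\le\kappa_{\max}$. Moreover $\bar d^2=o(\log n)$, $\sup_{x\in\Omega}|y(x)-\varphi(x)^T\beta^*|=O(\lambda_n)$, and $\lambda_n\asymp\sqrt{\log p/n}$, that is, $a\sqrt{\log p/n}\le\lambda_n\le b\sqrt{\log p/n}$ for all large $n$, with constants $0<a\le b<\infty$. In the stochastic case assume also that $a\ge A$, where $A$ is a suitable positive constant that depends only on the sub-Gaussian constant $K$ and on $\kappa_{\max}$. **Theorem.** In the deterministic case, and in the stochastic case, there is a constant $C_0>0$, not depending on $n$, such that with probability tending to $1$ as $n\to\infty$, $$\|\hat\beta-\beta^*\|_2^2\le C_0\,\frac{\bar c^2\,s\,\bar d\,\log p}{n}.$$ -/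

import Mathlib

open MeasureTheory ProbabilityTheory Filter Topology Asymptotics Matrix

noncomputable section

namespace OverlapLasso

/-! ### Sparse eigenvalues -/

/-- The matrix `(1/n) Φᵀ Φ` of a design matrix `Φ` with `n` rows. -/
def gram {n p : ℕ} (Φ : Matrix (Fin n) (Fin p) ℝ) : Matrix (Fin p) (Fin p) ℝ :=
  (1 / (n : ℝ)) • (Φᵀ * Φ)

/-- The `m`-sparse minimum eigenvalue `φ_min(m)` of `C`: the minimum of the Rayleigh quotient over
nonzero vectors with at most `m` nonzero entries (`m` may be any real number). -/
def sparseMinEigenvalue {p : ℕ} (C : Matrix (Fin p) (Fin p) ℝ) (m : ℝ) : EReal :=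
  ⨅ β : Fin p → ℝ, ⨅ _ : β ≠ 0 ∧ (hammingNorm β : ℝ) ≤ m,
    (((β ⬝ᵥ (C *ᵥ β)) / (β ⬝ᵥ β) : ℝ) : EReal)

/-- The `m`-sparse maximum eigenvalue `φ_max(m)` of `C`. -/
def sparseMaxEigenvalue {p : ℕ} (C : Matrix (Fin p) (Fin p) ℝ) (m : ℝ) : EReal :=
  ⨆ β : Fin p → ℝ, ⨆ _ : β ≠ 0 ∧ (hammingNorm β : ℝ) ≤ m,
    (((β ⬝ᵥ (C *ᵥ β)) / (β ⬝ᵥ β) : ℝ) : EReal)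

/-! ### Groups and the overlapping group lasso estimator -/

/-- The largest number `c̄` of groups that one variable belongs to. -/
def maxMultiplicity {p q : ℕ} (J : Fin q → Finset (Fin p)) : ℕ :=
  Finset.univ.sup fun k : Fin p => (Finset.univ.filter fun j : Fin q => k ∈ J j).card

/-- The size `d̄` of the largest group. -/
def maxGroupSize {p q : ℕ} (J : Fin q → Finset (Fin p)) : ℕ :=
  Finset.univ.sup fun j : Fin q => (J j).card

/-- The coefficient vector obtained from the duplicated coefficients `v j k` (the coefficient of
variable `k` in group `j`, relevant only for `k ∈ J j`): the `k`-th entry is the sum of `v j k` over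
all groups `j` that contain `k`. -/
def collapse {p q : ℕ} (J : Fin q → Finset (Fin p)) (v : Fin q → Fin p → ℝ) : Fin p → ℝ :=
  fun k => ∑ j ∈ Finset.univ.filter (fun j : Fin q => k ∈ J j), v j k

/-- The overlapping group lasso criterion
`(1/2n) ‖Y - Φ β‖² + lam * ∑ⱼ √dⱼ ‖v_{Jⱼ}‖₂` with `β = collapse J v` and `dⱼ = |Jⱼ|`. -/
def objective {n p q : ℕ} (Φ : Matrix (Fin n) (Fin p) ℝ) (Y : Fin n → ℝ)
    (J : Fin q → Finset (Fin p)) (lam : ℝ) (v : Fin q → Fin p → ℝ) : ℝ :=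
  1 / (2 * (n : ℝ)) * ∑ i, (Y i - (Φ *ᵥ collapse J v) i) ^ 2
    + lam * ∑ j, √((J j).card : ℝ) * √(∑ k ∈ J j, v j k ^ 2)

/-- `βhat` is an overlapping group lasso estimate: it is obtained by collapsing a minimizer of the
criterion over all duplicated coefficient vectors. -/
def IsEstimate {n p q : ℕ} (Φ : Matrix (Fin n) (Fin p) ℝ) (Y : Fin n → ℝ)
    (J : Fin q → Finset (Fin p)) (lam : ℝ) (βhat : Fin p → ℝ) : Prop :=
  ∃ v : Fin q → Fin p → ℝ,
    (∀ w : Fin q → Fin p → ℝ, objective Φ Y J lam v ≤ objective Φ Y J lam w) ∧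
      βhat = collapse J v

/-! ### The regression problem -/

/-- The nonrandom data of the problem, for every sample size `n`. -/
structure Problem (d : ℕ) where
  /-- the input domain -/
  domain : Set (Fin d → ℝ)
  /-- the true function (computer model) -/
  y : (Fin d → ℝ) → ℝ
  /-- number of basis functions at sample size `n` -/
  p : ℕ → ℕ
  /-- basis functions at sample size `n` -/
  basis : ∀ n, Fin (p n) → (Fin d → ℝ) → ℝ
  /-- number of groups at sample size `n` -/
  numGroups : ℕ → ℕ
  /-- groups at sample size `n` -/
  group : ∀ n, Fin (numGroups n) → Finset (Fin (p n))
  /-- best coefficients at sample size `n` -/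
  target : ∀ n, Fin (p n) → ℝ
  /-- penalty parameter at sample size `n` -/
  lam : ℕ → ℝ

namespace Problem

variable {d : ℕ} (P : Problem d)

/-- The linear combination `φ(z)ᵀ β` of the basis functions. -/
def lin (n : ℕ) (β : Fin (P.p n) → ℝ) (z : Fin d → ℝ) : ℝ :=
  ∑ k, P.basis n k z * β k

/-- The oracle risk `∫_Ω (y(z) - φ(z)ᵀ β)² dz`. -/
def oracleRisk (n : ℕ) (β : Fin (P.p n) → ℝ) : ℝ :=
  ∫ z in P.domain, (P.y z - P.lin n β z) ^ 2

/-- The maximal number of groups of a variable. -/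
def cbar (n : ℕ) : ℕ := maxMultiplicity (P.group n)

/-- The maximal group size. -/
def dbar (n : ℕ) : ℕ := maxGroupSize (P.group n)

/-- The number of nonzero best coefficients. -/
def s (n : ℕ) : ℕ := hammingNorm (P.target n)

/-- The scale `√(log p / n)` of the penalty parameter. -/
def lamScale (n : ℕ) : ℝ := √(Real.log (P.p n) / n)

/-- The design matrix with rows `φ(x₁)ᵀ, …, φ(xₙ)ᵀ` at the outcome `ω`. -/
def design {S : Type*} (x : ℕ → S → Fin d → ℝ) (n : ℕ) (ω : S) :
    Matrix (Fin n) (Fin (P.p n)) ℝ :=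
  Matrix.of fun i k => P.basis n k (x i ω)

/-- The responses `yᵢ = y(xᵢ) + εᵢ = φ(xᵢ)ᵀ β* + Bᵢ + εᵢ`, where `Bᵢ = y(xᵢ) - φ(xᵢ)ᵀ β*`. -/
def response {S : Type*} (x : ℕ → S → Fin d → ℝ) (ε : ℕ → S → ℝ) (n : ℕ) (ω : S) : Fin n → ℝ :=
  fun i => P.y (x i ω) + ε i ω

/-- The assumptions on the regression problem and on the (possibly random) inputs. -/
structure Assumptions {S : Type*} [MeasurableSpace S] (μ : Measure S)
    (x : ℕ → S → Fin d → ℝ) (κmin κmax : ℝ) : Prop where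
  measurableSet_domain : MeasurableSet P.domain
  volume_pos : 0 < volume P.domain
  volume_finite : volume P.domain < ⊤
  y_measurable : Measurable P.y
  y_memLp : MemLp P.y 2 (volume.restrict P.domain)
  basis_measurable : ∀ n k, Measurable (P.basis n k)
  basis_memLp : ∀ n k, MemLp (P.basis n k) 2 (volume.restrict P.domain)
  input_measurable : ∀ i, Measurable (x i)
  input_mem : ∀ i ω, x i ω ∈ P.domain
  /-- The empirical distribution functions of the inputs converge to that of the uniform
  distribution on the domain. -/
  input_uniform : ∀ᵐ ω ∂μ, ∀ t : Fin d → ℝ,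
    Tendsto (fun n : ℕ => (Set.ncard {i : ℕ | i < n ∧ x i ω ≤ t} : ℝ) / n) atTop
      (𝓝 (volume.real (P.domain ∩ Set.Iic t) / volume.real P.domain))
  p_tendsto : Tendsto P.p atTop atTop
  group_cover : ∀ n k, ∃ j, k ∈ P.group n j
  /-- `β*` minimizes the oracle risk. -/
  target_isMin : ∀ n β, P.oracleRisk n (P.target n) ≤ P.oracleRisk n β
  target_ne_zero : ∀ᶠ n in atTop, P.target n ≠ 0
  κmin_pos : 0 < κmin
  κmin_le : κmin ≤ κmax
  sparseMin : ∀ᵐ ω ∂μ, (κmin : EReal) ≤ liminf (fun n : ℕ =>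
    sparseMinEigenvalue (gram (P.design x n ω))
      ((P.s n : ℝ) * P.cbar n * P.dbar n * max (Real.log n) (P.cbar n))) atTop
  sparseMax : ∀ᵐ ω ∂μ, limsup (fun n : ℕ =>
    sparseMaxEigenvalue (gram (P.design x n ω))
      (((P.s n : ℝ) * P.cbar n + n) * P.dbar n)) atTop ≤ (κmax : EReal)
  dbar_sq : (fun n => (P.dbar n : ℝ) ^ 2) =o[atTop] (fun n : ℕ => Real.log n)
  /-- The sup norm over the domain of `y(·) - φ(·)ᵀ β*`, which is not random, is `O(λₙ)`. -/
  bias : ∃ K : ℝ, ∀ᶠ n in atTop, ∀ z ∈ P.domain, |P.y z - P.lin n (P.target n) z| ≤ K * P.lam n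

/-- With probability tending to one, every overlapping group lasso estimate satisfies
`‖βhat - β*‖₂² ≤ C c̄² s d̄ log p / n`, for a constant `C`. The probability of the complementary event
is required to tend to zero, in the sense of outer measure if the event is not measurable. -/
def L2Consistent {S : Type*} [MeasurableSpace S] (μ : Measure S)
    (x : ℕ → S → Fin d → ℝ) (ε : ℕ → S → ℝ) : Prop :=
  ∃ C : ℝ, 0 < C ∧ Tendsto (fun n : ℕ => μ {ω | ¬ ∀ βhat : Fin (P.p n) → ℝ,
      IsEstimate (P.design x n ω) (P.response x ε n ω) (P.group n) (P.lam n) βhat →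
        ∑ k, (βhat k - P.target n k) ^ 2
          ≤ C * ((P.cbar n : ℝ) ^ 2 * P.s n * P.dbar n * Real.log (P.p n) / n)})
    atTop (𝓝 0)

end Problem

/-- Independent and identically distributed mean-zero noise with variance `σ² > 0` that is
sub-Gaussian with constant `K`. -/
structure SubGaussianNoise {S : Type*} [MeasurableSpace S] (μ : Measure S)
    (ε : ℕ → S → ℝ) (K : ℝ) : Prop where
  measurable : ∀ i, Measurable (ε i)
  indep : iIndepFun ε μ
  identDistrib : ∀ i, IdentDistrib (ε i) (ε 0) μ μ
  tail : ∀ t : ℝ, 0 ≤ t → μ.real {ω | t < |ε 0 ω|} ≤ Real.exp (1 - t ^ 2 / K)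
  mean_zero : ∫ ω, ε 0 ω ∂μ = 0
  variance_pos : 0 < variance (ε 0) μ

end OverlapLasso

end

/-! Write h = β̂ − β*, m = s c̄ d̄, and let T be the union of the groups that meet the support of
β*, so that |T| ≤ m. The argument follows the lasso; overlap matters when penalties are compared.

A minimizing decomposition v of β̂ may be taken without cancellation (`exists_aligned`). From it β*
is decomposed by splitting h_k equally among the groups of k when k is in the support, and by zeros
elsewhere. Cauchy–Schwarz over the active groups bounds their penalty increase by √m ‖h_T‖₂, while
the inactive groups pay for ‖h_{Tᶜ}‖₁ because √d_j ‖v_j‖₂ ≥ ‖v_j‖₁ (`exists_penalty_comparison`).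
Minimality, a bias of order λ and noise correlations at most λ/4 then control both the prediction
error and λ ‖h_{Tᶜ}‖₁ by λ² + λ √m ‖h_T‖₂, up to constants (`basic_inequality`).

To return to ‖h‖₂, a set of at most Lm large coordinates is added to T; the remainder is cut into
blocks of norm sum at most ‖h_{Tᶜ}‖₁ / √(Lm) (`exists_finset_subadditive_le`). For L a large enough
multiple of κmax/κmin the remainder is absorbed, and `error_bound` gives ‖h‖₂² ≤ const · m λ², which
suffices since c̄ ≤ c̄².

It remains to make the two events likely. Since log n eventually exceeds L + 1, the minimum
eigenvalue hypothesis reaches (L + 1)m-sparse vectors; positivity there forces such vectors to be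
n-sparse, so the maximum eigenvalue hypothesis reaches them as well. The noise has a sub-Gaussian
moment generating function; with the inputs frozen, each column of squared norm at most 2 κmax n
gives a tail 2/p², and a union bound over p columns leaves 2/p. -/

namespace OverlapLasso

/-! ### Block decomposition of a vector -/

/-- The `N` largest values of a function on a finite type. -/
lemma exists_finset_card_eq_forall_le {ι : Type*} [Fintype ι] (f : ι → ℝ) (N : ℕ)
    (hN : N ≤ Fintype.card ι) :
    ∃ T : Finset ι, T.card = N ∧ ∀ i ∈ T, ∀ j ∉ T, f j ≤ f i := by
  classical
  induction N with
  | zero => exact ⟨∅, by simp⟩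
  | succ N ih =>
    obtain ⟨T, hT, hf⟩ := ih (by omega)
    have hne : (Tᶜ).Nonempty := by
      rw [← Finset.card_pos, Finset.card_compl]
      omega
    obtain ⟨a, ha, hmax⟩ := Finset.exists_max_image Tᶜ f hne
    have ha' : a ∉ T := by simpa using ha
    refine ⟨insert a T, by simp [ha', hT], ?_⟩
    intro i hi j hj
    rw [Finset.mem_insert, not_or] at hj
    rcases Finset.mem_insert.1 hi with rfl | hi
    · exact hmax j (by simpa using hj.2)
    · exact hf i hi j hj.2

lemma sum_abs_indicator_add_compl {ι : Type*} [Fintype ι] [DecidableEq ι] (T : Finset ι)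
    (f : ι → ℝ) :
    ∑ i, |f i| = ∑ i ∈ T, |f i| + ∑ i, |((T : Set ι)ᶜ.indicator f) i| := by
  rw [← Finset.sum_add_sum_compl T (fun i => |f i|)]
  congr 1
  rw [← Finset.sum_subset (Finset.subset_univ Tᶜ)]
  · refine Finset.sum_congr rfl fun i hi => ?_
    rw [Set.indicator_of_mem (by simpa using hi)]
  · intro i _ hi
    rw [Set.indicator_of_notMem (by simpa using hi), abs_zero]

/-- After removing its `N` largest entries, a vector splits into blocks of `N` entries whose
Euclidean norms add up to at most `‖f‖₁ / √N`; hence any subadditive functional that is bounded by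
`c` times the Euclidean norm on `N`-sparse vectors is at most `c ‖f‖₁ / √N` there. -/
lemma exists_finset_subadditive_le {ι : Type*} [Fintype ι] [DecidableEq ι] {N : ℕ} (hN : 0 < N)
    (f : ι → ℝ) :
    ∃ T : Finset ι, T.card ≤ N ∧ ∀ (G : (ι → ℝ) → ℝ) (c : ℝ), 0 ≤ c →
      (∀ x y, G (x + y) ≤ G x + G y) →
      (∀ x, hammingNorm x ≤ N → G x ≤ c * √(∑ i, x i ^ 2)) →
      G ((T : Set ι)ᶜ.indicator f) ≤ c / √N * ∑ i, |f i| := by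
  classical
  induction hm : hammingNorm f using Nat.strong_induction_on generalizing f with
  | _ m ih =>
  have hN' : (0 : ℝ) < N := by exact_mod_cast hN
  by_cases hmN : m ≤ N
  · refine ⟨Finset.univ.filter fun i => f i ≠ 0, by rw [← hm] at hmN; exact hmN, ?_⟩
    intro G c hc _ hG
    have h0 : ((Finset.univ.filter fun i => f i ≠ 0 : Finset ι) : Set ι)ᶜ.indicator f = 0 := by
      ext i
      by_cases hi : f i = 0 <;> simp [Set.indicator, hi]
    rw [h0]
    refine (hG 0 (by simp)).trans ?_
    simp only [Pi.zero_apply, ne_eq, OfNat.ofNat_ne_zero, not_false_eq_true, zero_pow,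
      Finset.sum_const_zero, Real.sqrt_zero, mul_zero]
    positivity
  · push Not at hmN
    obtain ⟨T, hT, hf⟩ := exists_finset_card_eq_forall_le (fun i => |f i|) N
      (hmN.le.trans (hm ▸ hammingNorm_le_card_fintype))
    -- A zero among the N largest entries would make every entry outside T vanish, although f has
    -- more than N nonzero entries. Hence removing T strictly lowers the support size and the
    -- induction applies.
    have hpos : ∀ i ∈ T, f i ≠ 0 := by
      have : ∃ j ∈ Finset.univ.filter (fun i => f i ≠ 0), j ∉ T := by
        refine Finset.exists_mem_notMem_of_card_lt_card ?_
        rw [hT]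
        exact hmN.trans_le hm.ge
      obtain ⟨j, hj, hjT⟩ := this
      intro i hi h0
      have := hf i hi j hjT
      simp only [h0, abs_zero, abs_nonpos_iff] at this
      simp [this] at hj
    set f' := (T : Set ι)ᶜ.indicator f with hf'
    have hlt : hammingNorm f' < m := by
      rw [← hm]
      refine Finset.card_lt_card (Finset.ssubset_iff_subset_ne.2 ⟨?_, ?_⟩)
      · intro i hi
        have hi' : f' i ≠ 0 := by simpa using hi
        have : f i ≠ 0 := fun h => hi' (by simp [hf', Set.indicator, h])
        simpa using this
      · intro heq
        obtain ⟨i, hi⟩ : T.Nonempty := by rw [← Finset.card_pos]; omega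
        have h1 : i ∈ Finset.univ.filter (fun i => f i ≠ 0) := by simpa using hpos i hi
        rw [← heq] at h1
        simp [hf', hi] at h1
    obtain ⟨T', hT', hG'⟩ := ih _ hlt f' rfl
    refine ⟨T, hT.le, ?_⟩
    intro G c hc hadd hG
    have hrest := hG' G c hc hadd hG
    have hsplit : f' = (T' : Set ι).indicator f' + (T' : Set ι)ᶜ.indicator f' :=
      (Set.indicator_self_add_compl _ _).symm
    set a := ∑ i ∈ T, |f i| with ha
    have ha0 : 0 ≤ a := Finset.sum_nonneg fun i _ => abs_nonneg _
    -- Each remaining entry is at most the mean of |f| over the previous block T. So the next block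
    -- T' has Euclidean norm at most a / √N, and its cost is charged to the ℓ¹ mass of T.
    have hsmall : ∀ i, |f' i| ≤ a / N := by
      intro i
      by_cases hi : i ∈ T
      · have : f' i = 0 := by simp [hf', hi]
        rw [this, abs_zero]
        positivity
      · have h1 : f' i = f i := by simp [hf', hi]
        rw [h1, le_div_iff₀ hN', mul_comm, ha]
        have := Finset.card_nsmul_le_sum T (fun j => |f j|) |f i| (fun j hj => hf j hj i hi)
        rwa [hT, nsmul_eq_mul] at this
    have hfirst : G ((T' : Set ι).indicator f') ≤ c / √N * a := by
      refine (hG _ ?_).trans ?_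
      · refine le_trans (Finset.card_le_card ?_) hT'
        intro i hi
        by_contra h
        simp [h] at hi
      · have h2 : ∑ i, ((T' : Set ι).indicator f') i ^ 2 ≤ N * (a / N) ^ 2 := by
          calc ∑ i, ((T' : Set ι).indicator f') i ^ 2
              = ∑ i ∈ T', f' i ^ 2 := by
                rw [← Finset.sum_subset (Finset.subset_univ T')]
                · exact Finset.sum_congr rfl fun i hi => by
                    rw [Set.indicator_of_mem (by simpa using hi)]
                · intro i _ hi
                  rw [Set.indicator_of_notMem (by simpa using hi)]
                  simp
            _ ≤ T'.card • (a / N) ^ 2 := by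
                refine Finset.sum_le_card_nsmul _ _ _ fun i _ => ?_
                exact sq_le_sq' (by linarith [neg_abs_le (f' i), hsmall i])
                  ((le_abs_self _).trans (hsmall i))
            _ ≤ N * (a / N) ^ 2 := by
                rw [nsmul_eq_mul]
                have : (T'.card : ℝ) ≤ N := by exact_mod_cast hT'
                gcongr
        have h3 : √(N * (a / N) ^ 2) = a / √N := by
          rw [Real.sqrt_mul hN'.le, Real.sqrt_sq (by positivity)]
          have h4 : √(N : ℝ) * √N = N := Real.mul_self_sqrt hN'.le
          have h5 : 0 < √(N : ℝ) := Real.sqrt_pos.2 hN'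
          field_simp
          rw [sq, h4, mul_comm]
        calc c * √(∑ i, ((T' : Set ι).indicator f') i ^ 2) ≤ c * (a / √N) := by
              rw [← h3]; gcongr
          _ = c / √N * a := by ring
    calc G f' ≤ G ((T' : Set ι).indicator f') + G ((T' : Set ι)ᶜ.indicator f') := by
          conv_lhs => rw [hsplit]
          exact hadd _ _
      _ ≤ c / √N * a + c / √N * ∑ i, |f' i| := add_le_add hfirst hrest
      _ = c / √N * ∑ i, |f i| := by rw [sum_abs_indicator_add_compl T f, mul_add]

/-! ### Sparse vectors and the design matrix -/

/-- If a matrix with `n` rows is injective on `M`-sparse vectors then all `M`-sparse vectors are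
`n`-sparse. -/
lemma hammingNorm_le_of_injective_sparse {n p M : ℕ} (Φ : Matrix (Fin n) (Fin p) ℝ)
    (hinj : ∀ β : Fin p → ℝ, hammingNorm β ≤ M → Φ *ᵥ β = 0 → β = 0)
    (β : Fin p → ℝ) (hβ : hammingNorm β ≤ M) : hammingNorm β ≤ n := by
  classical
  by_contra! hlt
  set T := Finset.univ.filter fun i => β i ≠ 0
  have hT : T.card = hammingNorm β := rfl
  let E : (T → ℝ) →ₗ[ℝ] (Fin p → ℝ) :=
    { toFun := fun c k => if hk : k ∈ T then c ⟨k, hk⟩ else 0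
      map_add' := fun c c' => by ext k; by_cases hk : k ∈ T <;> simp [hk]
      map_smul' := fun r c => by ext k; by_cases hk : k ∈ T <;> simp [hk] }
  have hker : ((Matrix.mulVecLin Φ).comp E).ker ≠ ⊥ := by
    apply LinearMap.ker_ne_bot_of_finrank_lt
    simp only [Module.finrank_fintype_fun_eq_card, Fintype.card_fin, Fintype.card_coe]
    omega
  obtain ⟨c, hc, hc0⟩ := Submodule.exists_mem_ne_zero_of_ne_bot hker
  refine hc0 ?_
  have hE : E c = 0 := by
    refine hinj _ (le_trans (Finset.card_le_card ?_) hβ) (by simpa using hc)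
    intro k hk
    simp only [E, LinearMap.coe_mk, AddHom.coe_mk, Finset.mem_filter, Finset.mem_univ, true_and,
      dite_eq_right_iff, not_forall, ne_eq] at hk
    exact hk.1
  ext ⟨k, hk⟩
  have := congrFun hE k
  simpa [E, hk] using this

/-! ### Duplicated coefficients -/

/-- The duplicated coefficients can be replaced by coefficients of smaller absolute value with the
same collapsed vector and such that no cancellation occurs in the collapsed vector. -/
lemma exists_aligned {p q : ℕ} (J : Fin q → Finset (Fin p)) (v : Fin q → Fin p → ℝ) :
    ∃ w : Fin q → Fin p → ℝ, collapse J w = collapse J v ∧ (∀ j, ∀ k ∈ J j, |w j k| ≤ |v j k|) ∧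
      ∀ k, ∑ j ∈ Finset.univ.filter (fun j => k ∈ J j), |w j k| ≤ |collapse J v k| := by
  set a : Fin p → ℝ := fun k => ∑ j ∈ Finset.univ.filter (fun j => k ∈ J j), |v j k| with ha
  have ha0 : ∀ k, 0 ≤ a k := fun k => Finset.sum_nonneg fun j _ => abs_nonneg _
  have hle : ∀ k, |collapse J v k| ≤ a k := fun k => Finset.abs_sum_le_sum_abs _ _
  -- The total is redistributed in proportion to |v j k|, so all shares of one variable have the
  -- same sign. If a k = 0 the total is zero too, and division by zero does no harm.
  refine ⟨fun j k => |v j k| * (collapse J v k / a k), ?_, ?_, ?_⟩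
  · ext k
    change ∑ j ∈ _, |v j k| * (collapse J v k / a k) = _
    rw [← Finset.sum_mul]
    change a k * _ = _
    by_cases h : a k = 0
    · have := hle k
      rw [h, abs_nonpos_iff] at this
      rw [h, this, zero_mul]
    · field_simp
  · intro j k _
    rw [abs_mul, abs_abs, abs_div, abs_of_nonneg (ha0 k)]
    exact mul_le_of_le_one_right (abs_nonneg _) (div_le_one_of_le₀ (hle k) (ha0 k))
  · intro k
    simp only [abs_mul, abs_abs, abs_div, abs_of_nonneg (ha0 k)]
    rw [← Finset.sum_mul]
    change a k * _ ≤ _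
    by_cases h : a k = 0
    · rw [h, zero_mul]
      exact abs_nonneg _
    · apply le_of_eq
      field_simp

lemma objective_le_of_collapse_eq {n p q : ℕ} (Φ : Matrix (Fin n) (Fin p) ℝ) (Y : Fin n → ℝ)
    (J : Fin q → Finset (Fin p)) {lam : ℝ} (hlam : 0 ≤ lam) {v w : Fin q → Fin p → ℝ}
    (hc : collapse J w = collapse J v) (hle : ∀ j, ∀ k ∈ J j, |w j k| ≤ |v j k|) :
    objective Φ Y J lam w ≤ objective Φ Y J lam v := by
  unfold objective
  rw [hc]
  refine add_le_add le_rfl (mul_le_mul_of_nonneg_left (Finset.sum_le_sum fun j _ => ?_) hlam)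
  refine mul_le_mul_of_nonneg_left (Real.sqrt_le_sqrt ?_) (Real.sqrt_nonneg _)
  exact Finset.sum_le_sum fun k hk => sq_le_sq.2 (hle j k hk)

/-- An estimate is the collapse of a minimizer without cancellation. -/
lemma IsEstimate.exists_aligned {n p q : ℕ} {Φ : Matrix (Fin n) (Fin p) ℝ} {Y : Fin n → ℝ}
    {J : Fin q → Finset (Fin p)} {lam : ℝ} (hlam : 0 ≤ lam) {βhat : Fin p → ℝ}
    (h : IsEstimate Φ Y J lam βhat) :
    ∃ v : Fin q → Fin p → ℝ, (∀ w, objective Φ Y J lam v ≤ objective Φ Y J lam w) ∧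
      βhat = collapse J v ∧
      ∀ k, ∑ j ∈ Finset.univ.filter (fun j => k ∈ J j), |v j k| ≤ |βhat k| := by
  obtain ⟨v, hv, rfl⟩ := h
  obtain ⟨w, hw, hwv, hsum⟩ := OverlapLasso.exists_aligned J v
  exact ⟨w, fun u => (objective_le_of_collapse_eq Φ Y J hlam hw hwv).trans (hv u), hw.symm, hsum⟩

/-! ### Groups meeting a support -/

/-- The groups that meet the support of `β`. -/
noncomputable def activeGroups {p q : ℕ} (J : Fin q → Finset (Fin p)) (β : Fin p → ℝ) :
    Finset (Fin q) :=
  Finset.univ.filter fun j => ∃ k ∈ J j, β k ≠ 0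

/-- The variables in the groups that meet the support of `β`. -/
noncomputable def activeVariables {p q : ℕ} (J : Fin q → Finset (Fin p)) (β : Fin p → ℝ) :
    Finset (Fin p) :=
  (activeGroups J β).biUnion J

/-- The total size of the active groups is bounded by `s c̄ d̄`. -/
lemma sum_card_activeGroups_le {p q : ℕ} (J : Fin q → Finset (Fin p)) (β : Fin p → ℝ) :
    ∑ j ∈ activeGroups J β, (J j).card
      ≤ hammingNorm β * maxMultiplicity J * maxGroupSize J := by
  have h1 : (activeGroups J β).card ≤ hammingNorm β * maxMultiplicity J := by
    have hsub : activeGroups J β ⊆ (Finset.univ.filter fun k => β k ≠ 0).biUnion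
        fun k => Finset.univ.filter fun j => k ∈ J j := by
      intro j hj
      simp only [activeGroups, Finset.mem_filter, Finset.mem_univ, true_and] at hj
      obtain ⟨k, hk, hβ⟩ := hj
      simp only [Finset.mem_biUnion, Finset.mem_filter, Finset.mem_univ, true_and]
      exact ⟨k, hβ, hk⟩
    refine (Finset.card_le_card hsub).trans (Finset.card_biUnion_le_card_mul _ _ _ fun k _ => ?_)
    exact Finset.le_sup (f := fun k : Fin p => (Finset.univ.filter fun j => k ∈ J j).card)
      (Finset.mem_univ k)
  calc ∑ j ∈ activeGroups J β, (J j).card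
      ≤ (activeGroups J β).card • maxGroupSize J :=
        Finset.sum_le_card_nsmul _ _ _ fun j _ =>
          Finset.le_sup (f := fun j => (J j).card) (Finset.mem_univ j)
    _ ≤ _ := by rw [smul_eq_mul]; gcongr

lemma card_activeVariables_le {p q : ℕ} (J : Fin q → Finset (Fin p)) (β : Fin p → ℝ) :
    (activeVariables J β).card ≤ hammingNorm β * maxMultiplicity J * maxGroupSize J :=
  Finset.card_biUnion_le.trans (sum_card_activeGroups_le J β)

lemma sum_activeGroups_le {p q : ℕ} (J : Fin q → Finset (Fin p)) (β : Fin p → ℝ)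
    (F : Fin q → Fin p → ℝ) (hF : ∀ j k, 0 ≤ F j k) :
    ∑ j ∈ activeGroups J β, ∑ k ∈ J j, F j k
      ≤ ∑ k ∈ activeVariables J β, ∑ j ∈ Finset.univ.filter (fun j => k ∈ J j), F j k := by
  have h : ∑ j ∈ activeGroups J β, ∑ k ∈ J j, F j k
      = ∑ k ∈ activeVariables J β,
          ∑ j ∈ (activeGroups J β).filter (fun j => k ∈ J j), F j k :=
    Finset.sum_comm' (by
      intro j k
      simp only [activeVariables, Finset.mem_biUnion, Finset.mem_filter]
      tauto)
  rw [h]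
  refine Finset.sum_le_sum fun k _ => ?_
  exact Finset.sum_le_sum_of_subset_of_nonneg
    (Finset.filter_subset_filter _ (Finset.subset_univ _)) fun j _ _ => hF j k

/-- No active group contains a variable outside the active variables, so exchanging the sums leaves
inactive groups only; the extra terms on the right are nonnegative. -/
lemma sum_inactive_le {p q : ℕ} (J : Fin q → Finset (Fin p)) (β : Fin p → ℝ)
    (F : Fin q → Fin p → ℝ) (hF : ∀ j k, 0 ≤ F j k) :
    ∑ k ∈ (activeVariables J β)ᶜ, ∑ j ∈ Finset.univ.filter (fun j => k ∈ J j), F j k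
      ≤ ∑ j ∈ (activeGroups J β)ᶜ, ∑ k ∈ J j, F j k := by
  have h : ∑ k ∈ (activeVariables J β)ᶜ, ∑ j ∈ Finset.univ.filter (fun j => k ∈ J j), F j k
      = ∑ j ∈ (activeGroups J β)ᶜ, ∑ k ∈ (J j).filter (fun k => k ∉ activeVariables J β), F j k :=
    Finset.sum_comm' (by
      intro k j
      simp only [activeVariables, Finset.mem_biUnion, Finset.mem_filter, Finset.mem_compl,
        Finset.mem_univ, true_and]
      constructor
      · rintro ⟨h1, h2⟩
        exact ⟨⟨h2, h1⟩, fun h3 => h1 ⟨j, h3, h2⟩⟩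
      · rintro ⟨⟨h1, h2⟩, _⟩
        exact ⟨h2, h1⟩)
  rw [h]
  refine Finset.sum_le_sum fun j _ => ?_
  exact Finset.sum_le_sum_of_subset_of_nonneg (Finset.filter_subset _ _) fun k _ _ => hF j k

/-! ### Comparison of penalties and the basic inequality. -/

lemma sum_abs_le_sqrt_card_mul {ι : Type*} (T : Finset ι) (f : ι → ℝ) :
    ∑ k ∈ T, |f k| ≤ √(T.card : ℝ) * √(∑ k ∈ T, f k ^ 2) := by
  rw [← Real.sqrt_mul (by positivity)]
  refine Real.le_sqrt_of_sq_le ?_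
  have := sq_sum_le_card_mul_sum_sq (s := T) (f := fun k => |f k|)
  simpa using this

lemma sqrt_sum_sq_le_add {ι : Type*} (T : Finset ι) (f g : ι → ℝ) :
    √(∑ k ∈ T, f k ^ 2) ≤ √(∑ k ∈ T, g k ^ 2) + √(∑ k ∈ T, (f k - g k) ^ 2) := by
  have key := norm_add_le (WithLp.toLp 2 fun k : T => g k)
    (WithLp.toLp 2 fun k : T => f k - g k)
  rw [← WithLp.toLp_add] at key
  simp only [EuclideanSpace.norm_eq, Real.norm_eq_abs, sq_abs, Pi.add_apply,
    add_sub_cancel] at key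
  rw [Finset.sum_coe_sort T fun k => f k ^ 2, Finset.sum_coe_sort T fun k => g k ^ 2,
    Finset.sum_coe_sort T fun k => (f k - g k) ^ 2] at key
  exact key

/-- The comparison of the penalties of an aligned decomposition `v` of `β̂` and a suitable
decomposition of `β`. -/
lemma exists_penalty_comparison {p q : ℕ} (J : Fin q → Finset (Fin p))
    (hcover : ∀ k, ∃ j, k ∈ J j) (β : Fin p → ℝ) (v : Fin q → Fin p → ℝ)
    (hv : ∀ k, ∑ j ∈ Finset.univ.filter (fun j => k ∈ J j), |v j k| ≤ |collapse J v k|) :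
    ∃ w : Fin q → Fin p → ℝ, collapse J w = β ∧
      ∑ j, √((J j).card : ℝ) * √(∑ k ∈ J j, w j k ^ 2)
        + ∑ k ∈ (activeVariables J β)ᶜ, |collapse J v k - β k|
      ≤ ∑ j, √((J j).card : ℝ) * √(∑ k ∈ J j, v j k ^ 2)
        + √((hammingNorm β * maxMultiplicity J * maxGroupSize J : ℕ) : ℝ)
          * √(∑ k ∈ activeVariables J β, (collapse J v k - β k) ^ 2) := by
  set h : Fin p → ℝ := fun k => collapse J v k - β k with hh
  set c : Fin p → ℝ := fun k => ((Finset.univ.filter fun j => k ∈ J j).card : ℝ) with hc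
  have hc1 : ∀ k, 1 ≤ c k := by
    intro k
    obtain ⟨j, hj⟩ := hcover k
    have : 0 < (Finset.univ.filter fun j => k ∈ J j).card :=
      Finset.card_pos.2 ⟨j, by simpa using hj⟩
    exact Nat.one_le_cast.2 this
  set w : Fin q → Fin p → ℝ := fun j k => if β k ≠ 0 then v j k - h k / c k else 0 with hw
  have hcol : collapse J w = β := by
    ext k
    by_cases hk : β k = 0
    · simp [collapse, hw, hk]
    · have : collapse J w k = collapse J v k - c k * (h k / c k) := by
        simp [collapse, hw, hk, Finset.sum_sub_distrib, hc]
      rw [this, mul_div_cancel₀ _ (by linarith [hc1 k] : c k ≠ 0)]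
      simp [hh]
  -- On the support the sum is h_k² / c_k, where c_k ≥ 1 counts the groups of k. Off the support w =
  -- 0 and h_k = β̂_k, so this is where the absence of cancellation in v enters. Either way the
  -- bound carries no factor c̄.
  have hdiff : ∀ k, ∑ j ∈ Finset.univ.filter (fun j => k ∈ J j), (w j k - v j k) ^ 2
      ≤ h k ^ 2 := by
    intro k
    by_cases hk : β k = 0
    · have h1 : h k = collapse J v k := by simp [hh, hk]
      rw [h1, ← sq_abs (collapse J v k)]
      calc ∑ j ∈ Finset.univ.filter (fun j => k ∈ J j), (w j k - v j k) ^ 2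
          = ∑ j ∈ Finset.univ.filter (fun j => k ∈ J j), |v j k| ^ 2 := by simp [hw, hk]
        _ ≤ (∑ j ∈ Finset.univ.filter (fun j => k ∈ J j), |v j k|) ^ 2 :=
            Finset.sum_sq_le_sq_sum_of_nonneg fun j _ => abs_nonneg _
        _ ≤ _ := by
            gcongr
            exact hv k
    · have h1 : ∑ j ∈ Finset.univ.filter (fun j => k ∈ J j), (w j k - v j k) ^ 2
          = c k * (h k / c k) ^ 2 := by
        simp [hw, hk, hc]
      have h0 : 0 < c k := by linarith [hc1 k]
      rw [h1, div_pow, mul_div_assoc', div_le_iff₀ (by positivity)]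
      nlinarith [sq_nonneg (h k), hc1 k, mul_nonneg (sq_nonneg (h k)) h0.le]
  refine ⟨w, hcol, ?_⟩
  set A := activeGroups J β with hA
  set T := activeVariables J β with hT
  set m := hammingNorm β * maxMultiplicity J * maxGroupSize J with hm
  rw [← Finset.sum_add_sum_compl A fun j => √((J j).card : ℝ) * √(∑ k ∈ J j, w j k ^ 2),
    ← Finset.sum_add_sum_compl A fun j => √((J j).card : ℝ) * √(∑ k ∈ J j, v j k ^ 2)]
  have hinact : ∑ j ∈ Aᶜ, √((J j).card : ℝ) * √(∑ k ∈ J j, w j k ^ 2) = 0 := by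
    refine Finset.sum_eq_zero fun j hj => ?_
    have hj' : ∀ k ∈ J j, β k = 0 := by
      simpa [hA, activeGroups] using hj
    rw [Finset.sum_eq_zero, Real.sqrt_zero, mul_zero]
    intro k hk
    simp [hw, hj' k hk]
  have hact : ∑ j ∈ A, √((J j).card : ℝ) * √(∑ k ∈ J j, w j k ^ 2)
      ≤ ∑ j ∈ A, √((J j).card : ℝ) * √(∑ k ∈ J j, v j k ^ 2)
        + ∑ j ∈ A, √((J j).card : ℝ) * √(∑ k ∈ J j, (w j k - v j k) ^ 2) := by
    rw [← Finset.sum_add_distrib]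
    refine Finset.sum_le_sum fun j _ => ?_
    rw [← mul_add]
    gcongr
    exact sqrt_sum_sq_le_add _ _ _
  have hcs : ∑ j ∈ A, √((J j).card : ℝ) * √(∑ k ∈ J j, (w j k - v j k) ^ 2)
      ≤ √(m : ℝ) * √(∑ k ∈ T, h k ^ 2) := by
    refine (Real.sum_sqrt_mul_sqrt_le A (fun j => Nat.cast_nonneg _)
      (fun j => Finset.sum_nonneg fun k _ => sq_nonneg _)).trans ?_
    gcongr
    · exact_mod_cast sum_card_activeGroups_le J β
    · refine (sum_activeGroups_le J β (fun j k => (w j k - v j k) ^ 2)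
        fun j k => sq_nonneg _).trans ?_
      exact Finset.sum_le_sum fun k _ => hdiff k
  have hout : ∑ k ∈ Tᶜ, |h k| ≤ ∑ j ∈ Aᶜ, √((J j).card : ℝ) * √(∑ k ∈ J j, v j k ^ 2) := by
    calc ∑ k ∈ Tᶜ, |h k|
        ≤ ∑ k ∈ Tᶜ, ∑ j ∈ Finset.univ.filter (fun j => k ∈ J j), |v j k| := by
          refine Finset.sum_le_sum fun k hk => ?_
          have hβ : β k = 0 := by
            by_contra hne
            obtain ⟨j, hj⟩ := hcover k
            rw [Finset.mem_compl] at hk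
            refine hk (Finset.mem_biUnion.2 ⟨j, ?_, hj⟩)
            simp only [activeGroups, Finset.mem_filter, Finset.mem_univ, true_and]
            exact ⟨k, hj, hne⟩
          have : h k = collapse J v k := by simp [hh, hβ]
          rw [this]
          exact Finset.abs_sum_le_sum_abs _ _
      _ ≤ ∑ j ∈ Aᶜ, ∑ k ∈ J j, |v j k| :=
          sum_inactive_le J β (fun j k => |v j k|) fun j k => abs_nonneg _
      _ ≤ _ := Finset.sum_le_sum fun j _ => sum_abs_le_sqrt_card_mul _ _
  linarith

/-- The basic inequality for the overlapping group lasso. -/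
lemma basic_inequality {n p q : ℕ} (hn : 0 < n) (Φ : Matrix (Fin n) (Fin p) ℝ) (Y : Fin n → ℝ)
    (J : Fin q → Finset (Fin p)) (hcover : ∀ k, ∃ j, k ∈ J j) {lam b : ℝ} (hlam : 0 ≤ lam)
    (β βhat : Fin p → ℝ) (hest : IsEstimate Φ Y J lam βhat) (B ε : Fin n → ℝ)
    (hY : ∀ i, Y i = (Φ *ᵥ β) i + B i + ε i) (hB : ∀ i, |B i| ≤ b * lam)
    (hε : ∀ k, |1 / (n : ℝ) * ∑ i, ε i * Φ i k| ≤ lam / 4) :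
    1 / (n : ℝ) * ∑ i, (Φ *ᵥ (βhat - β)) i ^ 2 / 4
        + 3 / 4 * lam * ∑ k ∈ (activeVariables J β)ᶜ, |(βhat - β) k|
      ≤ b ^ 2 * lam ^ 2
        + 5 / 4 * lam * (√((hammingNorm β * maxMultiplicity J * maxGroupSize J : ℕ) : ℝ)
          * √(∑ k ∈ activeVariables J β, (βhat - β) k ^ 2)) := by
  obtain ⟨v, hmin, rfl, hv⟩ := hest.exists_aligned hlam
  obtain ⟨w, hw, hpen⟩ := exists_penalty_comparison J hcover β v hv
  set h := collapse J v - β with hh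
  set T := activeVariables J β
  set m := hammingNorm β * maxMultiplicity J * maxGroupSize J
  set X := Φ *ᵥ h with hX
  have hn' : (0 : ℝ) < n := by exact_mod_cast hn
  have hobj := hmin w
  unfold objective at hobj
  rw [hw] at hobj
  have e1 : ∀ i, Y i - (Φ *ᵥ β) i = B i + ε i := fun i => by rw [hY i]; ring
  have e2 : ∀ i, Y i - (Φ *ᵥ collapse J v) i = B i + ε i - X i := fun i => by
    rw [hX, hh, Matrix.mulVec_sub, hY i, Pi.sub_apply]; ring
  simp only [e1, e2] at hobj
  have e3 : ∑ i, (B i + ε i - X i) ^ 2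
      = ∑ i, (B i + ε i) ^ 2 - 2 * ∑ i, B i * X i - 2 * ∑ i, ε i * X i + ∑ i, X i ^ 2 := by
    simp only [Finset.mul_sum, ← Finset.sum_sub_distrib, ← Finset.sum_add_distrib]
    exact Finset.sum_congr rfl fun i _ => by ring
  -- From B X ≤ B² + X²/4: half of the quadratic term X²/2 of the loss is spent on the bias, and a
  -- quarter remains.
  have hbias : ∑ i, B i * X i ≤ n * (b ^ 2 * lam ^ 2) + (∑ i, X i ^ 2) / 4 := by
    calc ∑ i, B i * X i ≤ ∑ i, (b ^ 2 * lam ^ 2 + X i ^ 2 / 4) := by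
          refine Finset.sum_le_sum fun i _ => ?_
          have : B i ^ 2 ≤ (b * lam) ^ 2 := by
            rw [← sq_abs]
            gcongr
            exact hB i
          nlinarith [sq_nonneg (B i - X i / 2)]
      _ = _ := by
          rw [Finset.sum_add_distrib, Finset.sum_div]
          simp
  -- Splitting this ℓ¹ norm over T and its complement turns the penalty coefficients 1 and 1 into
  -- 5/4 on T and 3/4 off T.
  have hnoise : 1 / (n : ℝ) * ∑ i, ε i * X i ≤ lam / 4 * ∑ k, |h k| := by
    have : 1 / (n : ℝ) * ∑ i, ε i * X i
        = ∑ k, (1 / (n : ℝ) * ∑ i, ε i * Φ i k) * h k := by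
      simp only [hX, Matrix.mulVec, dotProduct, Finset.mul_sum, Finset.sum_mul]
      rw [Finset.sum_comm]
      exact Finset.sum_congr rfl fun k _ => Finset.sum_congr rfl fun i _ => by ring
    rw [this, Finset.mul_sum]
    refine Finset.sum_le_sum fun k _ => (le_abs_self _).trans ?_
    rw [abs_mul]
    gcongr
    exact hε k
  have hl1 : ∑ k, |h k| ≤ √(m : ℝ) * √(∑ k ∈ T, h k ^ 2) + ∑ k ∈ Tᶜ, |h k| := by
    rw [← Finset.sum_add_sum_compl T fun k => |h k|]
    gcongr
    refine (sum_abs_le_sqrt_card_mul T h).trans ?_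
    gcongr
    exact card_activeVariables_le J β
  have hpen' := mul_le_mul_of_nonneg_left hpen hlam
  have hl1' := mul_le_mul_of_nonneg_left hl1 hlam
  have hbias' := mul_le_mul_of_nonneg_left hbias (by positivity : 0 ≤ 1 / (n : ℝ))
  rw [e3] at hobj
  have e4 : ∀ k, collapse J v k - β k = h k := fun k => rfl
  simp only [e4] at hpen'
  have e5 : 1 / (2 * (n : ℝ)) = 1 / n / 2 := by field_simp
  rw [e5] at hobj
  have e6 : 1 / (n : ℝ) * (n * (b ^ 2 * lam ^ 2) + (∑ i, X i ^ 2) / 4)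
      = b ^ 2 * lam ^ 2 + 1 / (n : ℝ) * (∑ i, X i ^ 2) / 4 := by field_simp
  rw [e6] at hbias'
  rw [← Finset.sum_div, ← mul_div_assoc]
  nlinarith

/-! ### Estimation error under restricted eigenvalues -/

lemma sqrt_sum_sq_add_le {ι : Type*} (T : Finset ι) (f g : ι → ℝ) :
    √(∑ k ∈ T, (f k + g k) ^ 2) ≤ √(∑ k ∈ T, f k ^ 2) + √(∑ k ∈ T, g k ^ 2) := by
  simpa using sqrt_sum_sq_le_add T (fun k => f k + g k) f

lemma sum_sq_indicator {ι : Type*} [Fintype ι] (T : Finset ι) (f : ι → ℝ) :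
    ∑ i, ((T : Set ι).indicator f) i ^ 2 = ∑ i ∈ T, f i ^ 2 := by
  classical
  rw [← Finset.sum_subset (Finset.subset_univ T)]
  · exact Finset.sum_congr rfl fun i hi => by rw [Set.indicator_of_mem (by simpa using hi)]
  · intro i _ hi
    rw [Set.indicator_of_notMem (by simpa using hi)]
    simp

lemma hammingNorm_indicator_le {ι : Type*} [Fintype ι] (T : Finset ι) (f : ι → ℝ) :
    hammingNorm ((T : Set ι).indicator f) ≤ T.card := by
  refine Finset.card_le_card fun i hi => ?_
  by_contra h
  simp [h] at hi

/-- The factor in the bound for the Euclidean error on the large coordinates. -/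
noncomputable def mainFactor (κ b : ℝ) : ℝ := 2 * (2 * b + 10 / √κ + √κ * b ^ 2 / 5) / √κ

/-- The constant in the bound for the squared Euclidean error. -/
noncomputable def errorConst (κ b : ℝ) : ℝ :=
  mainFactor κ b ^ 2 + (4 / 3 * b ^ 2 + 5 / 3 * mainFactor κ b) ^ 2

/-- In the application, g = √κ₁, k = √κ₂, l = √L, mu = √m; t, a, r are the Euclidean norms of h on
T, on the enlarged set U and off U; z is the ℓ¹ norm off T; Q and R are the empirical norms of h and
of its part off U. The condition 20k ≤ 3gl makes R cost at most ga/4 plus a multiple of lam, and Q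
is bounded likewise, so ga/2 survives on the left of `hmain`. -/
lemma error_bound_arith {κ b g k l lam mu a r t z Q R : ℝ} (hgκ : g = √κ) (hg : 0 < g)
    (hb : 0 ≤ b) (hl : 1 ≤ l) (hlam : 0 < lam) (hmu : 1 ≤ mu) (ht : 0 ≤ t)
    (hr : 0 ≤ r) (hta : t ≤ a) (hkl : 20 * k ≤ 3 * g * l) (hz : 0 ≤ z)
    (hbasic : Q ^ 2 / 4 + 3 / 4 * lam * z ≤ b ^ 2 * lam ^ 2 + 5 / 4 * lam * (mu * t))
    (hmain : g * a ≤ Q + R) (hR : R ≤ k / (l * mu) * z) (hrz : r ≤ 1 / (l * mu) * z) :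
    a ^ 2 + r ^ 2 ≤ errorConst κ b * (mu ^ 2 * lam ^ 2) := by
  have hl0 : 0 < l := by linarith
  have hmu0 : 0 < mu := by linarith
  have ha : 0 ≤ a := ht.trans hta
  have hta' : lam * (mu * t) ≤ lam * (mu * a) := by gcongr
  have hz' : z ≤ 4 / 3 * b ^ 2 * lam + 5 / 3 * mu * a := by
    have : lam * (3 / 4 * z) ≤ lam * (b ^ 2 * lam + 5 / 4 * (mu * a)) := by
      nlinarith [sq_nonneg Q]
    have := le_of_mul_le_mul_left this hlam
    linarith
  have hzmu : 1 / mu * z ≤ 4 / 3 * b ^ 2 * lam + 5 / 3 * a := by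
    rw [one_div_mul_eq_div, div_le_iff₀ hmu0]
    have : 0 ≤ 4 / 3 * b ^ 2 * lam := by positivity
    nlinarith
  have hzmu0 : 0 ≤ 1 / mu * z := by positivity
  have hR' : R ≤ g / 5 * b ^ 2 * lam + g * a / 4 := by
    have h1 : k / l ≤ 3 * g / 20 := by
      rw [div_le_iff₀ hl0]; linarith
    calc R ≤ k / (l * mu) * z := hR
      _ = k / l * (1 / mu * z) := by field_simp
      _ ≤ 3 * g / 20 * (4 / 3 * b ^ 2 * lam + 5 / 3 * a) := by gcongr
      _ = _ := by ring
  have hr' : r ≤ 4 / 3 * b ^ 2 * lam + 5 / 3 * a := by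
    calc r ≤ 1 / (l * mu) * z := hrz
      _ = 1 / l * (1 / mu * z) := by field_simp
      _ ≤ 1 * (1 / mu * z) := by
          gcongr
          rw [div_le_one hl0]
          exact hl
      _ ≤ _ := by linarith
  -- The weights are balanced so that twice the product of the last two terms is exactly 5 lam mu a,
  -- the cross term in the bound for Q².
  have hQ : Q ≤ 2 * b * lam + g * a / 4 + 10 * lam * mu / g := by
    have hx : 0 ≤ 2 * b * lam := by positivity
    have hy : 0 ≤ g * a / 4 := by positivity
    have hw : 0 ≤ 10 * lam * mu / g := by positivity
    refine le_of_sq_le_sq ?_ (by positivity)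
    have hyw : g * a / 4 * (10 * lam * mu / g) = 5 / 2 * (lam * (mu * a)) := by
      field_simp
      ring
    have : Q ^ 2 ≤ (2 * b * lam) ^ 2 + 5 * (lam * (mu * a)) := by
      nlinarith [mul_nonneg hlam.le hz]
    nlinarith [mul_nonneg hx hy, mul_nonneg hx hw, sq_nonneg (g * a / 4),
      sq_nonneg (10 * lam * mu / g)]
  have hD : a ≤ mainFactor κ b * (mu * lam) := by
    have h1 : g * a / 2 ≤ 2 * b * lam + 10 * lam * mu / g + g / 5 * b ^ 2 * lam := by linarith
    have h2 : 2 * b * lam + g / 5 * b ^ 2 * lam ≤ (2 * b * lam + g / 5 * b ^ 2 * lam) * mu := by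
      exact le_mul_of_one_le_right (by positivity) hmu
    have h3 : mainFactor κ b * (mu * lam)
        = 2 * ((2 * b * lam + g / 5 * b ^ 2 * lam) * mu + 10 * lam * mu / g) / g := by
      rw [mainFactor, ← hgκ]
      field_simp
      ring
    rw [h3, le_div_iff₀ hg]
    linarith
  have hr2 : r ≤ (4 / 3 * b ^ 2 + 5 / 3 * mainFactor κ b) * (mu * lam) := by
    have : 4 / 3 * b ^ 2 * lam ≤ 4 / 3 * b ^ 2 * lam * mu :=
      le_mul_of_one_le_right (by positivity) hmu
    linarith
  have h4 := pow_le_pow_left₀ ha hD 2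
  have h5 := pow_le_pow_left₀ hr hr2 2
  rw [errorConst]
  linarith

/-- The Euclidean error of the overlapping group lasso on the event that the noise is dominated by
the penalty and the Gram matrix is well conditioned on sparse vectors. -/
theorem error_bound {n p q : ℕ} (hn : 0 < n) (Φ : Matrix (Fin n) (Fin p) ℝ) (Y : Fin n → ℝ)
    (J : Fin q → Finset (Fin p)) (hcover : ∀ k, ∃ j, k ∈ J j) {lam b κ₁ κ₂ : ℝ} (hlam : 0 < lam)
    (hb : 0 ≤ b) (hκ₁ : 0 < κ₁) (hκ₂ : 0 < κ₂) (β βhat : Fin p → ℝ)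
    (hest : IsEstimate Φ Y J lam βhat) (B ε : Fin n → ℝ)
    (hY : ∀ i, Y i = (Φ *ᵥ β) i + B i + ε i) (hB : ∀ i, |B i| ≤ b * lam)
    (hε : ∀ k, |1 / (n : ℝ) * ∑ i, ε i * Φ i k| ≤ lam / 4) {m L : ℕ}
    (hm : m = hammingNorm β * maxMultiplicity J * maxGroupSize J) (hm0 : 0 < m)
    (hL : 400 * κ₂ ≤ 9 * κ₁ * L)
    (hmin : ∀ x : Fin p → ℝ, hammingNorm x ≤ (L + 1) * m →
      κ₁ * ∑ k, x k ^ 2 ≤ 1 / (n : ℝ) * ∑ i, (Φ *ᵥ x) i ^ 2)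
    (hmax : ∀ x : Fin p → ℝ, hammingNorm x ≤ (L + 1) * m →
      1 / (n : ℝ) * ∑ i, (Φ *ᵥ x) i ^ 2 ≤ κ₂ * ∑ k, x k ^ 2) :
    ∑ k, (βhat k - β k) ^ 2 ≤ errorConst κ₁ b * (m * lam ^ 2) := by
  classical
  have hbasic := basic_inequality hn Φ Y J hcover hlam.le β βhat hest B ε hY hB hε
  rw [← hm] at hbasic
  have hTcard := card_activeVariables_le J β
  rw [← hm] at hTcard
  change ∑ k, (βhat - β) k ^ 2 ≤ _
  set h := βhat - β
  set T := activeVariables J β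
  have hL0 : 0 < L := by
    rcases Nat.eq_zero_or_pos L with h0 | h0
    · rw [h0, Nat.cast_zero, mul_zero] at hL
      linarith
    · exact h0
  obtain ⟨T₁, hT₁, hshell⟩ := exists_finset_subadditive_le (Nat.mul_pos hL0 hm0)
    ((T : Set (Fin p))ᶜ.indicator h)
  set U := T ∪ T₁ with hU
  have hrest : (T₁ : Set (Fin p))ᶜ.indicator ((T : Set (Fin p))ᶜ.indicator h)
      = ((Uᶜ : Finset (Fin p)) : Set (Fin p)).indicator h := by
    rw [Set.indicator_indicator, hU]
    congr 1
    ext k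
    simp [and_comm]
  rw [hrest] at hshell
  have hl1 : ∑ k, |((T : Set (Fin p))ᶜ.indicator h) k| = ∑ k ∈ Tᶜ, |h k| := by
    have h1 := sum_abs_indicator_add_compl T h
    have h2 := Finset.sum_add_sum_compl T fun k => |h k|
    linarith
  rw [hl1] at hshell
  have hle : L * m ≤ (L + 1) * m := Nat.mul_le_mul_right _ (Nat.le_succ L)
  have hfac : ∀ x : Fin p → ℝ, √(1 / (n : ℝ) * ∑ i, (Φ *ᵥ x) i ^ 2)
      = √(1 / (n : ℝ)) * √(∑ i, (Φ *ᵥ x) i ^ 2) := fun x => Real.sqrt_mul (by positivity) _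
  have hΦadd : ∀ x y : Fin p → ℝ, √(1 / (n : ℝ) * ∑ i, (Φ *ᵥ (x + y)) i ^ 2)
      ≤ √(1 / (n : ℝ) * ∑ i, (Φ *ᵥ x) i ^ 2) + √(1 / (n : ℝ) * ∑ i, (Φ *ᵥ y) i ^ 2) := by
    intro x y
    rw [hfac, hfac, hfac, ← mul_add, Matrix.mulVec_add]
    gcongr
    exact sqrt_sum_sq_add_le _ _ _
  -- The block bound is used twice on the same remainder: for the empirical seminorm with factor
  -- √κ₂, then for the Euclidean norm with factor 1.
  have hR := hshell (fun x => √(1 / (n : ℝ) * ∑ i, (Φ *ᵥ x) i ^ 2)) √κ₂ (Real.sqrt_nonneg _)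
    hΦadd fun x hx => by
      rw [← Real.sqrt_mul hκ₂.le]
      exact Real.sqrt_le_sqrt (hmax x (hx.trans hle))
  have hr := hshell (fun x => √(∑ k, x k ^ 2)) 1 zero_le_one
    (fun x y => sqrt_sum_sq_add_le _ x y) (fun x _ => by rw [one_mul])
  have hsplit : h = (U : Set (Fin p)).indicator h
      + ((Uᶜ : Finset (Fin p)) : Set (Fin p)).indicator h := by
    rw [Finset.coe_compl]
    exact (Set.indicator_self_add_compl _ _).symm
  have hUcard : U.card ≤ (L + 1) * m := by
    calc U.card ≤ T.card + T₁.card := Finset.card_union_le _ _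
      _ ≤ m + L * m := add_le_add hTcard hT₁
      _ = (L + 1) * m := by ring
  have hmain : √κ₁ * √(∑ k ∈ U, h k ^ 2) ≤ √(1 / (n : ℝ) * ∑ i, (Φ *ᵥ h) i ^ 2)
      + √(1 / (n : ℝ) * ∑ i, (Φ *ᵥ ((Uᶜ : Finset (Fin p)) : Set (Fin p)).indicator h) i ^ 2) := by
    have h1 := Real.sqrt_le_sqrt
      (hmin _ ((hammingNorm_indicator_le U h).trans hUcard))
    rw [sum_sq_indicator, Real.sqrt_mul hκ₁.le] at h1
    refine h1.trans ?_
    have h2 : (U : Set (Fin p)).indicator h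
        = h + -((Uᶜ : Finset (Fin p)) : Set (Fin p)).indicator h :=
      eq_add_neg_of_add_eq hsplit.symm
    conv_lhs => rw [h2]
    refine (hΦadd _ _).trans (le_of_eq ?_)
    simp only [Matrix.mulVec_neg, Pi.neg_apply, neg_sq]
  have hm1 : (1 : ℝ) ≤ m := by exact_mod_cast hm0
  have hL1 : (1 : ℝ) ≤ L := by exact_mod_cast hL0
  have hN : √((L * m : ℕ) : ℝ) = √(L : ℝ) * √(m : ℝ) := by
    rw [Nat.cast_mul, Real.sqrt_mul (by positivity)]
  rw [hN] at hR hr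
  simp only [sum_sq_indicator] at hr
  have hQ : √(1 / (n : ℝ) * ∑ i, (Φ *ᵥ h) i ^ 2) ^ 2
      = 1 / (n : ℝ) * ∑ i, (Φ *ᵥ h) i ^ 2 := Real.sq_sqrt (by positivity)
  have hkl : 20 * √κ₂ ≤ 3 * √κ₁ * √(L : ℝ) := by
    have h1 : 20 * √κ₂ = √(400 * κ₂) := by
      rw [Real.sqrt_mul (by norm_num), show (400 : ℝ) = 20 ^ 2 by norm_num,
        Real.sqrt_sq (by norm_num)]
    have h2 : 3 * √κ₁ * √(L : ℝ) = √(9 * κ₁ * L) := by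
      rw [Real.sqrt_mul (by positivity), Real.sqrt_mul (by norm_num),
        show (9 : ℝ) = 3 ^ 2 by norm_num, Real.sqrt_sq (by norm_num)]
    rw [h1, h2]
    exact Real.sqrt_le_sqrt hL
  rw [← Finset.sum_div, ← mul_div_assoc, ← hQ] at hbasic
  have key := error_bound_arith (κ := κ₁) rfl (Real.sqrt_pos.2 hκ₁) hb
    (Real.one_le_sqrt.2 hL1) hlam (Real.one_le_sqrt.2 hm1) (Real.sqrt_nonneg _)
    (Real.sqrt_nonneg _)
    (Real.sqrt_le_sqrt (Finset.sum_le_sum_of_subset_of_nonneg Finset.subset_union_left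
      fun k _ _ => sq_nonneg (h k)))
    hkl (Finset.sum_nonneg fun k _ => abs_nonneg _) hbasic hmain hR hr
  rw [Real.sq_sqrt (Finset.sum_nonneg fun k _ => sq_nonneg _),
    Real.sq_sqrt (Finset.sum_nonneg fun k _ => sq_nonneg _), Finset.sum_add_sum_compl,
    Real.sq_sqrt (by positivity)] at key
  exact key

/-! ### Sub-Gaussian noise -/

/-- The linear term is kept explicit so that it vanishes on integration against a centred variable.
For |x| ≤ 1 the Taylor remainder is at most x² ≤ exp(x²) − 1; beyond that, the size of x² suffices.
-/
lemma exp_le_add_exp_sq (x : ℝ) : Real.exp x ≤ x + Real.exp (x ^ 2) := by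
  have h1 := Real.add_one_le_exp (x ^ 2)
  rcases le_total |x| 1 with hx | hx
  · have := (abs_le.1 (Real.abs_exp_sub_one_sub_id_le hx)).2
    linarith
  · rcases le_abs.1 hx with h | h
    · have : Real.exp x ≤ Real.exp (x ^ 2) := Real.exp_le_exp.2 (by nlinarith)
      linarith
    · have : Real.exp x ≤ 1 := Real.exp_le_one_iff.2 (by linarith)
      nlinarith

lemma exp_mul_le_of_mem_Icc {s : ℝ} (hs0 : 0 ≤ s) (hs1 : s ≤ 1) (y : ℝ) :
    Real.exp (s * y) ≤ 1 - s + s * Real.exp y := by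
  have := convexOn_exp.2 (Set.mem_univ 0) (Set.mem_univ y) (sub_nonneg.2 hs1) hs0 (by ring)
  simpa using this

lemma lintegral_Ioi_one_const_mul_rpow_neg_two (c : ℝ) (hc : 0 ≤ c) :
    ∫⁻ t in Set.Ioi (1 : ℝ), ENNReal.ofReal (c * t ^ (-2 : ℝ)) = ENNReal.ofReal c := by
  rw [← ofReal_integral_eq_lintegral_ofReal]
  · rw [integral_const_mul, integral_Ioi_rpow_of_lt (by norm_num) one_pos]
    norm_num
  · exact (integrableOn_Ioi_rpow_of_lt (by norm_num) one_pos).const_mul c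
  · filter_upwards [ae_restrict_mem measurableSet_Ioi] with t ht
    have : (0 : ℝ) < t := lt_trans one_pos ht
    positivity

section SubGaussian

variable {S : Type*} [MeasurableSpace S] {μ : Measure S} [IsProbabilityMeasure μ] {X : S → ℝ}
  {K : ℝ}

/-- Layer-cake formula: levels up to 1 contribute at most 1. At a level t > 1 the tail bound at √(2K
log t) gives e · t⁻², whose integral is e. -/
lemma lintegral_exp_sq_le (hK : 0 < K) (hX : Measurable X)
    (htail : ∀ t : ℝ, 0 ≤ t → μ.real {ω | t < |X ω|} ≤ Real.exp (1 - t ^ 2 / K)) :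
    ∫⁻ ω, ENNReal.ofReal (Real.exp (X ω ^ 2 / (2 * K))) ∂μ
      ≤ ENNReal.ofReal (1 + Real.exp 1) := by
  rw [lintegral_eq_lintegral_meas_lt μ (Eventually.of_forall fun ω => (Real.exp_pos _).le)
    (by fun_prop), ← Set.Ioc_union_Ioi_eq_Ioi (zero_le_one' ℝ),
    lintegral_union measurableSet_Ioi (Set.Ioc_disjoint_Ioi le_rfl),
    ENNReal.ofReal_add zero_le_one (Real.exp_pos 1).le,
    ← lintegral_Ioi_one_const_mul_rpow_neg_two _ (Real.exp_pos 1).le]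
  refine add_le_add ?_ ?_
  · calc ∫⁻ t in Set.Ioc (0 : ℝ) 1, μ {ω | t < Real.exp (X ω ^ 2 / (2 * K))}
        ≤ ∫⁻ _ in Set.Ioc (0 : ℝ) 1, 1 := lintegral_mono fun _ => prob_le_one
      _ = ENNReal.ofReal 1 := by simp
  · refine setLIntegral_mono' measurableSet_Ioi fun t ht => ?_
    have ht1 : (1 : ℝ) < t := ht
    have ht0 : 0 < t := lt_trans one_pos ht1
    have hlog : 0 ≤ Real.log t := Real.log_nonneg ht1.le
    have hsub : {ω | t < Real.exp (X ω ^ 2 / (2 * K))} ⊆ {ω | √(2 * K * Real.log t) < |X ω|} := by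
      intro ω hω
      rw [Set.mem_ofPred_eq, ← Real.log_lt_iff_lt_exp ht0, lt_div_iff₀ (by positivity)] at hω
      rw [Set.mem_ofPred_eq, Real.sqrt_lt' ?_, sq_abs]
      · linarith
      · by_contra h
        have h0 : X ω = 0 := by simpa using h
        rw [h0] at hω
        have : 0 ≤ Real.log t * (2 * K) := by positivity
        linarith
    refine (measure_mono hsub).trans ?_
    rw [← ofReal_measureReal]
    refine ENNReal.ofReal_le_ofReal ((htail _ (Real.sqrt_nonneg _)).trans (le_of_eq ?_))
    rw [Real.sq_sqrt (by positivity), Real.rpow_def_of_pos ht0, ← Real.exp_add]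
    congr 1
    field_simp
    ring

lemma integrable_exp_sq (hK : 0 < K) (hX : Measurable X)
    (htail : ∀ t : ℝ, 0 ≤ t → μ.real {ω | t < |X ω|} ≤ Real.exp (1 - t ^ 2 / K)) :
    Integrable (fun ω => Real.exp (X ω ^ 2 / (2 * K))) μ := by
  refine ⟨by fun_prop, ?_⟩
  rw [hasFiniteIntegral_iff_ofReal (Eventually.of_forall fun ω => (Real.exp_pos _).le)]
  exact (lintegral_exp_sq_le hK hX htail).trans_lt ENNReal.ofReal_lt_top

lemma integral_exp_sq_le (hK : 0 < K) (hX : Measurable X)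
    (htail : ∀ t : ℝ, 0 ≤ t → μ.real {ω | t < |X ω|} ≤ Real.exp (1 - t ^ 2 / K)) :
    ∫ ω, Real.exp (X ω ^ 2 / (2 * K)) ∂μ ≤ 1 + Real.exp 1 := by
  rw [integral_eq_lintegral_of_nonneg_ae (Eventually.of_forall fun ω => (Real.exp_pos _).le)
    (by fun_prop)]
  exact ENNReal.toReal_le_of_le_ofReal (by positivity) (lintegral_exp_sq_le hK hX htail)

/-- A centred random variable with sub-Gaussian tails has a sub-Gaussian moment generating
function. -/
lemma hasSubgaussianMGF_of_tail (hK : 0 < K) (hX : Measurable X)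
    (htail : ∀ t : ℝ, 0 ≤ t → μ.real {ω | t < |X ω|} ≤ Real.exp (1 - t ^ 2 / K))
    (hmean : ∫ ω, X ω ∂μ = 0) : HasSubgaussianMGF X (12 * K).toNNReal μ := by
  have hint := integrable_exp_sq hK hX htail
  have hle := integral_exp_sq_le hK hX htail
  have he : Real.exp 1 < 3 := Real.exp_one_lt_three
  have hyoung : ∀ t x : ℝ, t * x ≤ K * t ^ 2 + 1 / 2 * (x ^ 2 / (2 * K)) := by
    intro t x
    have : K * t ^ 2 + 1 / 2 * (x ^ 2 / (2 * K)) - t * x = K * (t - x / (2 * K)) ^ 2 := by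
      field_simp
      ring
    have h2 : 0 ≤ K * (t - x / (2 * K)) ^ 2 := by positivity
    linarith
  have hbound : ∀ t x : ℝ, Real.exp (t * x)
      ≤ Real.exp (K * t ^ 2) * (1 / 2 + 1 / 2 * Real.exp (x ^ 2 / (2 * K))) := by
    intro t x
    calc Real.exp (t * x) ≤ Real.exp (K * t ^ 2 + 1 / 2 * (x ^ 2 / (2 * K))) :=
          Real.exp_le_exp.2 (hyoung t x)
      _ ≤ _ := by
          rw [Real.exp_add]
          gcongr
          have := exp_mul_le_of_mem_Icc (s := 1 / 2) (by norm_num) (by norm_num) (x ^ 2 / (2 * K))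
          linarith
  have hint' : Integrable (fun ω => 1 / 2 + 1 / 2 * Real.exp (X ω ^ 2 / (2 * K))) μ :=
    (integrable_const _).add (hint.const_mul _)
  have hintt : ∀ t : ℝ, Integrable (fun ω => Real.exp (t * X ω)) μ := fun t =>
    (hint'.const_mul (Real.exp (K * t ^ 2))).mono' (by fun_prop)
      (Eventually.of_forall fun ω => by
        rw [Real.norm_of_nonneg (Real.exp_pos _).le]
        exact hbound t (X ω))
  have hXint : Integrable X μ := by
    refine ((integrable_const (K / 2)).add hint).mono' hX.aestronglyMeasurable
      (Eventually.of_forall fun ω => ?_)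
    have h1 := Real.add_one_le_exp (X ω ^ 2 / (2 * K))
    have h2 : X ω ^ 2 / (2 * K) + K / 2 - |X ω| = (|X ω| - K) ^ 2 / (2 * K) := by
      rw [← sq_abs (X ω)]
      field_simp
      ring
    have h3 : 0 ≤ (|X ω| - K) ^ 2 / (2 * K) := by positivity
    rw [Real.norm_eq_abs, Pi.add_apply]
    linarith
  refine ⟨hintt, fun t => ?_⟩
  rw [Real.coe_toNNReal _ (by positivity), mgf]
  -- For small t, centring and convexity give 1 + 6Kt². For large t, Young's inequality loses a
  -- factor at most 5/2, which 1 + 5Kt² dominates. Both are at most exp(6Kt²), hence the variance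
  -- proxy 12K.
  rcases le_total (2 * K * t ^ 2) 1 with ht | ht
  · have hs : 0 ≤ 2 * K * t ^ 2 := by positivity
    have hint₂ : Integrable (fun ω => 1 - 2 * K * t ^ 2
        + 2 * K * t ^ 2 * Real.exp (X ω ^ 2 / (2 * K))) μ :=
      (integrable_const _).add (hint.const_mul _)
    calc ∫ ω, Real.exp (t * X ω) ∂μ
        ≤ ∫ ω, (t * X ω + (1 - 2 * K * t ^ 2
            + 2 * K * t ^ 2 * Real.exp (X ω ^ 2 / (2 * K)))) ∂μ := by
          refine integral_mono (hintt t) ((hXint.const_mul t).add hint₂) fun ω => ?_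
          refine (exp_le_add_exp_sq (t * X ω)).trans (add_le_add le_rfl ?_)
          have := exp_mul_le_of_mem_Icc hs ht (X ω ^ 2 / (2 * K))
          have h2 : 2 * K * t ^ 2 * (X ω ^ 2 / (2 * K)) = (t * X ω) ^ 2 := by
            field_simp
          rwa [h2] at this
      _ = 1 - 2 * K * t ^ 2 + 2 * K * t ^ 2 * ∫ ω, Real.exp (X ω ^ 2 / (2 * K)) ∂μ := by
          rw [integral_add (hXint.const_mul t) hint₂,
            integral_add (integrable_const _) (hint.const_mul _), integral_const_mul,
            integral_const_mul, hmean]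
          simp
      _ ≤ 1 - 2 * K * t ^ 2 + 2 * K * t ^ 2 * (1 + 3) := by
          gcongr
          linarith
      _ = 12 * K * t ^ 2 / 2 + 1 := by ring
      _ ≤ _ := Real.add_one_le_exp _
  · calc ∫ ω, Real.exp (t * X ω) ∂μ
        ≤ ∫ ω, Real.exp (K * t ^ 2) * (1 / 2 + 1 / 2 * Real.exp (X ω ^ 2 / (2 * K))) ∂μ :=
          integral_mono (hintt t) (hint'.const_mul _) fun ω => hbound t (X ω)
      _ = Real.exp (K * t ^ 2) * (1 / 2 + 1 / 2 * ∫ ω, Real.exp (X ω ^ 2 / (2 * K)) ∂μ) := by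
          rw [integral_const_mul, integral_add (integrable_const _) (hint.const_mul _),
            integral_const_mul]
          simp
      _ ≤ Real.exp (K * t ^ 2) * (5 * K * t ^ 2 + 1) := by
          refine mul_le_mul_of_nonneg_left ?_ (Real.exp_pos _).le
          linarith
      _ ≤ Real.exp (K * t ^ 2) * Real.exp (5 * K * t ^ 2) := by
          gcongr
          exact Real.add_one_le_exp _
      _ = _ := by
          rw [← Real.exp_add]
          congr 1
          ring

end SubGaussian

/-! ### Concentration of weighted noise sums, with fixed and with random weights. -/

section Concentration

variable {S : Type*} [MeasurableSpace S] {μ : Measure S}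

lemma HasSubgaussianMGF_mono {X : S → ℝ} {c c' : NNReal} (h : HasSubgaussianMGF X c μ)
    (hc : c ≤ c') : HasSubgaussianMGF X c' μ :=
  ⟨h.integrable_exp_mul, fun t => (h.mgf_le t).trans (Real.exp_le_exp.2 (by
    have : (c : ℝ) ≤ c' := hc
    gcongr))⟩

variable [IsProbabilityMeasure μ]

/-- Concentration of weighted sums of independent sub-Gaussian random variables. -/
lemma measureReal_lt_abs_weighted_sum_le {ε : ℕ → S → ℝ} {c V : ℝ} (hc : 0 ≤ c) (hV : 0 ≤ V)
    (hind : iIndepFun ε μ) (hsub : ∀ i, HasSubgaussianMGF (ε i) c.toNNReal μ) {n : ℕ}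
    (z : Fin n → ℝ) (hz : ∑ i, z i ^ 2 ≤ V) {t : ℝ} (ht : 0 ≤ t) :
    μ.real {ω | t < |∑ i, z i * ε i ω|} ≤ 2 * Real.exp (-t ^ 2 / (2 * (V * c))) := by
  have hind' : iIndepFun (fun (i : Fin n) ω => z i * ε i ω) μ :=
    (hind.precomp Fin.val_injective).comp (fun i y => z i * y) fun i => by fun_prop
  have hscale : ∀ i : Fin n,
      HasSubgaussianMGF (fun ω => z i * ε i ω) (z i ^ 2 * c).toNNReal μ := fun i =>
    HasSubgaussianMGF_mono ((hsub i).const_mul (z i)) (le_of_eq (NNReal.eq (by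
      rw [Real.coe_toNNReal _ (by positivity)]
      change z i ^ 2 * (c.toNNReal : ℝ) = z i ^ 2 * c
      rw [Real.coe_toNNReal c hc])))
  have hsum : HasSubgaussianMGF (fun ω => ∑ i, z i * ε i ω) (V * c).toNNReal μ := by
    refine HasSubgaussianMGF_mono
      (HasSubgaussianMGF.sum_of_iIndepFun hind' fun i _ => hscale i) ?_
    rw [← Real.toNNReal_sum_of_nonneg fun i _ => by positivity, ← Finset.sum_mul]
    exact Real.toNNReal_le_toNNReal (by gcongr)
  have h1 := hsum.measure_ge_le ht
  have h2 := hsum.neg.measure_ge_le ht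
  rw [Real.coe_toNNReal _ (by positivity)] at h1 h2
  have hle : {ω | t < |∑ i, z i * ε i ω|}
      ⊆ {ω | t ≤ ∑ i, z i * ε i ω} ∪ {ω | t ≤ (-fun ω => ∑ i, z i * ε i ω) ω} := by
    intro ω hω
    rw [Set.mem_ofPred_eq] at hω
    rcases lt_abs.1 hω with h | h
    · exact Or.inl h.le
    · exact Or.inr h.le
  calc μ.real {ω | t < |∑ i, z i * ε i ω|} ≤ _ := measureReal_mono hle
    _ ≤ _ := measureReal_union_le _ _
    _ ≤ _ := by linarith

/-- A bound for the sections of a product set gives a bound for the probability of the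
corresponding event for independent random elements. -/
lemma measure_pair_mem_le_of_indepFun {α γ : Type*} [MeasurableSpace α] [MeasurableSpace γ]
    {Z : S → α} {W : S → γ} (hZ : Measurable Z) (hW : Measurable W) (hind : IndepFun Z W μ)
    {B : Set (α × γ)} (hB : MeasurableSet B) {δ : ENNReal}
    (h : ∀ z, μ {ω | (z, W ω) ∈ B} ≤ δ) : μ {ω | (Z ω, W ω) ∈ B} ≤ δ := by
  have h1 : μ {ω | (Z ω, W ω) ∈ B} = μ.map (fun ω => (Z ω, W ω)) B :=
    (Measure.map_apply (hZ.prodMk hW) hB).symm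
  have : IsProbabilityMeasure (μ.map Z) := Measure.isProbabilityMeasure_map hZ.aemeasurable
  have : IsProbabilityMeasure (μ.map W) := Measure.isProbabilityMeasure_map hW.aemeasurable
  rw [h1, hind.map_prod_eq_prod_map_map hZ.aemeasurable hW.aemeasurable, Measure.prod_apply hB]
  calc ∫⁻ z, μ.map W (Prod.mk z ⁻¹' B) ∂μ.map Z ≤ ∫⁻ _, δ ∂μ.map Z := by
        refine lintegral_mono fun z => ?_
        rw [Measure.map_apply hW (measurable_prodMk_left hB)]
        exact h z
    _ = δ := by simp

/-- Concentration of sums of independent sub-Gaussian random variables with independent random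
weights. -/
lemma measure_random_weighted_sum_le {ε : ℕ → S → ℝ} {c V : ℝ} (hc : 0 ≤ c) (hV : 0 ≤ V)
    (hmeas : ∀ i, Measurable (ε i)) (hind : iIndepFun ε μ)
    (hsub : ∀ i, HasSubgaussianMGF (ε i) c.toNNReal μ) {n : ℕ} {Z : S → Fin n → ℝ}
    (hZ : Measurable Z) (hZε : IndepFun Z (fun ω (i : Fin n) => ε i ω) μ) {t : ℝ} (ht : 0 ≤ t) :
    μ {ω | ∑ i, Z ω i ^ 2 ≤ V ∧ t < |∑ i, Z ω i * ε i ω|}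
      ≤ ENNReal.ofReal (2 * Real.exp (-t ^ 2 / (2 * (V * c)))) := by
  have hB : MeasurableSet {zw : (Fin n → ℝ) × (Fin n → ℝ) |
      ∑ i, zw.1 i ^ 2 ≤ V ∧ t < |∑ i, zw.1 i * zw.2 i|} := by
    rw [Set.ofPred_and]
    exact (measurableSet_le (by fun_prop) measurable_const).inter
      (measurableSet_lt measurable_const (by fun_prop))
  have hW : Measurable fun ω (i : Fin n) => ε i ω := measurable_pi_lambda _ fun i => hmeas i
  refine measure_pair_mem_le_of_indepFun hZ hW hZε hB fun z => ?_
  -- The size condition on the weights belongs to the event, so sections with large weights are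
  -- empty and the bound is uniform over all z.
  by_cases hz : ∑ i, z i ^ 2 ≤ V
  · simp only [Set.mem_ofPred_eq, hz, true_and]
    rw [← ofReal_measureReal]
    exact ENNReal.ofReal_le_ofReal (measureReal_lt_abs_weighted_sum_le hc hV hind hsub z hz ht)
  · simp [hz]

end Concentration

/-! ### Well-conditioned designs -/

/-- The Rayleigh quotient of the Gram matrix lies between `κ₁` and `κ₂` on `M`-sparse vectors. -/
def WellConditioned {n p : ℕ} (Φ : Matrix (Fin n) (Fin p) ℝ) (M : ℕ) (κ₁ κ₂ : ℝ) : Prop :=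
  ∀ β : Fin p → ℝ, hammingNorm β ≤ M →
    κ₁ * ∑ k, β k ^ 2 ≤ 1 / (n : ℝ) * ∑ i, (Φ *ᵥ β) i ^ 2 ∧
      1 / (n : ℝ) * ∑ i, (Φ *ᵥ β) i ^ 2 ≤ κ₂ * ∑ k, β k ^ 2

lemma dotProduct_self_eq_sum_sq {ι : Type*} [Fintype ι] (β : ι → ℝ) : β ⬝ᵥ β = ∑ k, β k ^ 2 :=
  Finset.sum_congr rfl fun k _ => (sq (β k)).symm

lemma dotProduct_gram_mulVec {n p : ℕ} (Φ : Matrix (Fin n) (Fin p) ℝ) (β : Fin p → ℝ) :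
    β ⬝ᵥ (gram Φ *ᵥ β) = 1 / (n : ℝ) * ∑ i, (Φ *ᵥ β) i ^ 2 := by
  rw [gram, Matrix.smul_mulVec, dotProduct_smul, smul_eq_mul, ← Matrix.mulVec_mulVec,
    Matrix.dotProduct_mulVec, Matrix.vecMul_transpose, dotProduct_self_eq_sum_sq]

lemma sum_sq_pos {ι : Type*} [Fintype ι] {β : ι → ℝ} (hβ : β ≠ 0) : 0 < ∑ k, β k ^ 2 := by
  obtain ⟨k, hk⟩ := Function.ne_iff.1 hβ
  exact Finset.sum_pos' (fun _ _ => sq_nonneg _) ⟨k, Finset.mem_univ k, by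
    have : β k ≠ 0 := hk
    positivity⟩

lemma le_of_lt_sparseMinEigenvalue {n p : ℕ} {Φ : Matrix (Fin n) (Fin p) ℝ} {κ r : ℝ}
    (h : (κ : EReal) < sparseMinEigenvalue (gram Φ) r) {β : Fin p → ℝ}
    (hβ : (hammingNorm β : ℝ) ≤ r) :
    κ * ∑ k, β k ^ 2 ≤ 1 / (n : ℝ) * ∑ i, (Φ *ᵥ β) i ^ 2 := by
  by_cases h0 : β = 0
  · simp [h0]
  · have h1 : sparseMinEigenvalue (gram Φ) r
        ≤ (((β ⬝ᵥ (gram Φ *ᵥ β)) / (β ⬝ᵥ β) : ℝ) : EReal) :=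
      iInf₂_le (f := fun (β : Fin p → ℝ) (_ : β ≠ 0 ∧ (hammingNorm β : ℝ) ≤ r) =>
        (((β ⬝ᵥ (gram Φ *ᵥ β)) / (β ⬝ᵥ β) : ℝ) : EReal)) β ⟨h0, hβ⟩
    have h2 := EReal.coe_lt_coe_iff.1 (h.trans_le h1)
    rw [dotProduct_gram_mulVec, dotProduct_self_eq_sum_sq, lt_div_iff₀ (sum_sq_pos h0)] at h2
    exact h2.le

lemma le_of_sparseMaxEigenvalue_lt {n p : ℕ} {Φ : Matrix (Fin n) (Fin p) ℝ} {κ r : ℝ}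
    (h : sparseMaxEigenvalue (gram Φ) r < (κ : EReal)) {β : Fin p → ℝ}
    (hβ : (hammingNorm β : ℝ) ≤ r) :
    1 / (n : ℝ) * ∑ i, (Φ *ᵥ β) i ^ 2 ≤ κ * ∑ k, β k ^ 2 := by
  by_cases h0 : β = 0
  · simp [h0]
  · have h1 : (((β ⬝ᵥ (gram Φ *ᵥ β)) / (β ⬝ᵥ β) : ℝ) : EReal)
        ≤ sparseMaxEigenvalue (gram Φ) r :=
      le_iSup₂ (f := fun (β : Fin p → ℝ) (_ : β ≠ 0 ∧ (hammingNorm β : ℝ) ≤ r) =>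
        (((β ⬝ᵥ (gram Φ *ᵥ β)) / (β ⬝ᵥ β) : ℝ) : EReal)) β ⟨h0, hβ⟩
    have h2 := EReal.coe_lt_coe_iff.1 (h1.trans_lt h)
    rw [dotProduct_gram_mulVec, dotProduct_self_eq_sum_sq, div_lt_iff₀ (sum_sq_pos h0)] at h2
    exact h2.le

/-- Sparse vectors on which the Gram matrix is positive definite are `n`-sparse, so that the sparse
maximum eigenvalue is only needed at the level `n`. -/
lemma wellConditioned_of_sparseEigenvalues {n p : ℕ} {Φ : Matrix (Fin n) (Fin p) ℝ}
    {κ₁ κ₂ r r' : ℝ} {M : ℕ} (hκ₁ : 0 < κ₁) (hM : (M : ℝ) ≤ r) (hn : (n : ℝ) ≤ r')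
    (hmin : (κ₁ : EReal) < sparseMinEigenvalue (gram Φ) r)
    (hmax : sparseMaxEigenvalue (gram Φ) r' < (κ₂ : EReal)) : WellConditioned Φ M κ₁ κ₂ := by
  have h1 : ∀ β : Fin p → ℝ, hammingNorm β ≤ M →
      κ₁ * ∑ k, β k ^ 2 ≤ 1 / (n : ℝ) * ∑ i, (Φ *ᵥ β) i ^ 2 := fun β hβ =>
    le_of_lt_sparseMinEigenvalue hmin (le_trans (by exact_mod_cast hβ) hM)
  refine fun β hβ => ⟨h1 β hβ, le_of_sparseMaxEigenvalue_lt hmax (le_trans ?_ hn)⟩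
  have : hammingNorm β ≤ n := hammingNorm_le_of_injective_sparse Φ (fun γ hγ h0 => by
    by_contra hne
    have h2 := h1 γ hγ
    rw [h0] at h2
    simp only [Pi.zero_apply, ne_eq, OfNat.ofNat_ne_zero, not_false_eq_true, zero_pow,
      Finset.sum_const_zero, mul_zero] at h2
    have := mul_pos hκ₁ (sum_sq_pos hne)
    linarith) β hβ
  exact_mod_cast this

/-- Test the upper bound on a coordinate vector. This controls the variance of the noise
correlations. -/
lemma WellConditioned.sum_sq_column_le {n p : ℕ} {Φ : Matrix (Fin n) (Fin p) ℝ} {κ₁ κ₂ : ℝ}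
    {M : ℕ} (h : WellConditioned Φ M κ₁ κ₂) (hn : 0 < n) (hM : 1 ≤ M) (k : Fin p) :
    ∑ i, Φ i k ^ 2 ≤ n * κ₂ := by
  have hn' : (0 : ℝ) < n := by exact_mod_cast hn
  have hnorm : hammingNorm (Pi.single k (1 : ℝ) : Fin p → ℝ) ≤ M := by
    refine le_trans (Finset.card_le_card (t := {k}) fun j hj => ?_) (by simpa using hM)
    by_contra hne
    simp only [Finset.mem_singleton] at hne
    simp [hne] at hj
  have h2 := (h _ hnorm).2
  have h3 : ∑ j, (Pi.single k (1 : ℝ) : Fin p → ℝ) j ^ 2 = 1 := by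
    rw [Finset.sum_eq_single k] <;> simp +contextual
  simp only [Matrix.mulVec_single_one, Matrix.col_apply] at h2
  rw [h3, mul_one, one_div_mul_eq_div, div_le_iff₀ hn', mul_comm] at h2
  exact h2

/-- Closedness yields measurability of the event even though the condition ranges over uncountably
many vectors. -/
lemma isClosed_wellConditioned (n p M : ℕ) (κ₁ κ₂ : ℝ) :
    IsClosed {Φ : Fin n → Fin p → ℝ | WellConditioned (Matrix.of Φ) M κ₁ κ₂} := by
  simp only [WellConditioned, Set.ofPred_forall]
  refine isClosed_iInter fun β => isClosed_iInter fun _ => ?_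
  rw [Set.ofPred_and]
  simp only [Matrix.mulVec, dotProduct, Matrix.of_apply]
  exact (isClosed_le (by fun_prop) (by fun_prop)).inter (isClosed_le (by fun_prop) (by fun_prop))

/-! ### Asymptotics: probabilities of the two good events and consistency. -/

namespace Problem

variable {d : ℕ} {P : Problem d} {S : Type*} [MeasurableSpace S] {μ : Measure S}
  {x : ℕ → S → Fin d → ℝ} {κmin κmax : ℝ}

lemma measurableSet_wellConditioned (hP : P.Assumptions μ x κmin κmax) (n M : ℕ) (κ₁ κ₂ : ℝ) :
    MeasurableSet {ω | WellConditioned (P.design x n ω) M κ₁ κ₂} := by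
  have hmeas : Measurable fun ω (i : Fin n) (k : Fin (P.p n)) => P.basis n k (x i ω) :=
    measurable_pi_lambda _ fun i => measurable_pi_lambda _ fun k =>
      (hP.basis_measurable n k).comp (hP.input_measurable i)
  exact hmeas (isClosed_wellConditioned n (P.p n) M κ₁ κ₂).measurableSet

/-- The product `s c̄ d̄`. -/
noncomputable def sparsity (P : Problem d) (n : ℕ) : ℕ := P.s n * P.cbar n * P.dbar n

lemma cbar_pos_and_dbar_pos (hP : P.Assumptions μ x κmin κmax) {n : ℕ} (hn : P.target n ≠ 0) :
    0 < P.cbar n ∧ 0 < P.dbar n := by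
  obtain ⟨k, -⟩ := Function.ne_iff.1 hn
  obtain ⟨j, hj⟩ := hP.group_cover n k
  constructor
  · refine lt_of_lt_of_le (Finset.card_pos.2 ⟨j, by simpa using hj⟩)
      (Finset.le_sup (f := fun k : Fin (P.p n) =>
        (Finset.univ.filter fun j => k ∈ P.group n j).card) (Finset.mem_univ k))
  · exact lt_of_lt_of_le (Finset.card_pos.2 ⟨k, hj⟩)
      (Finset.le_sup (f := fun j => (P.group n j).card) (Finset.mem_univ j))

lemma sparsity_pos (hP : P.Assumptions μ x κmin κmax) {n : ℕ} (hn : P.target n ≠ 0) :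
    0 < P.sparsity n :=
  Nat.mul_pos (Nat.mul_pos (hammingNorm_pos_iff.2 hn) (cbar_pos_and_dbar_pos hP hn).1)
    (cbar_pos_and_dbar_pos hP hn).2

/-- The designs are well conditioned with probability tending to one. -/
lemma tendsto_measure_not_wellConditioned [IsProbabilityMeasure μ]
    (hP : P.Assumptions μ x κmin κmax) (L : ℕ) :
    Tendsto (fun n => μ {ω | WellConditioned (P.design x n ω) ((L + 1) * P.sparsity n)
      (κmin / 2) (2 * κmax)}ᶜ) atTop (𝓝 0) := by
  have hκmin := hP.κmin_pos
  have hκmax : 0 < κmax := hκmin.trans_le hP.κmin_le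
  have hlog : ∀ᶠ n : ℕ in atTop, ((L + 1 : ℕ) : ℝ) ≤ Real.log n :=
    (Real.tendsto_log_atTop.comp tendsto_natCast_atTop_atTop).eventually_ge_atTop _
  have hae : ∀ᵐ ω ∂μ, ∀ᶠ n in atTop,
      WellConditioned (P.design x n ω) ((L + 1) * P.sparsity n) (κmin / 2) (2 * κmax) := by
    filter_upwards [hP.sparseMin, hP.sparseMax] with ω h1 h2
    -- Halving κmin and doubling κmax gives the strict inequalities needed to pass from liminf and
    -- limsup to all large n.
    have h1' : ((κmin / 2 : ℝ) : EReal) < (κmin : EReal) :=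
      EReal.coe_lt_coe_iff.2 (by linarith)
    have h2' : (κmax : EReal) < ((2 * κmax : ℝ) : EReal) :=
      EReal.coe_lt_coe_iff.2 (by linarith)
    filter_upwards [eventually_lt_of_lt_liminf (h1'.trans_le h1),
      eventually_lt_of_limsup_lt (h2.trans_lt h2'), hlog, hP.target_ne_zero]
      with n hn1 hn2 hn3 hn4
    refine wellConditioned_of_sparseEigenvalues (by linarith) ?_ ?_ hn1 hn2
    · rw [sparsity]
      push_cast
      push_cast at hn3
      rw [mul_comm]
      gcongr
      exact hn3.trans (le_max_left _ _)
    · have hd : (1 : ℝ) ≤ P.dbar n := by exact_mod_cast (cbar_pos_and_dbar_pos hP hn4).2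
      calc (n : ℝ) ≤ (P.s n : ℝ) * P.cbar n + n := le_add_of_nonneg_left (by positivity)
        _ ≤ _ := le_mul_of_one_le_right (by positivity) hd
  have := tendsto_measure_of_ae_tendsto_indicator_of_isFiniteMeasure (μ := μ) (A := ∅) atTop
    MeasurableSet.empty
    (fun n => (measurableSet_wellConditioned hP n ((L + 1) * P.sparsity n) (κmin / 2)
      (2 * κmax)).compl) (by
      filter_upwards [hae] with ω hω
      filter_upwards [hω] with n hn
      simpa using hn)
  simpa using this

/-- The event that the correlation of the noise with some (bounded) basis function is not dominated
by the penalty. -/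
def noiseEvent (P : Problem d) (x : ℕ → S → Fin d → ℝ) (ε : ℕ → S → ℝ) (κ : ℝ) (n : ℕ) : Set S :=
  {ω | ∃ k : Fin (P.p n), ∑ i : Fin n, P.basis n k (x i ω) ^ 2 ≤ n * κ ∧
    n * P.lam n / 4 < |∑ i : Fin n, P.basis n k (x i ω) * ε i ω|}

/-- Off the noise event and on the well-conditioned event the argument is deterministic:
conditioning bounds all columns, so the noise event can fail only through small correlations, and
`error_bound` applies. Both settings then differ only in the noise event. -/
theorem consistent_of_tendsto_noiseEvent [IsProbabilityMeasure μ]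
    (hP : P.Assumptions μ x κmin κmax) {ε : ℕ → S → ℝ}
    (hlam : ∃ a b : ℝ, 0 < a ∧ 0 < b ∧ ∀ᶠ n in atTop,
      a * P.lamScale n ≤ P.lam n ∧ P.lam n ≤ b * P.lamScale n)
    (hnoise : Tendsto (fun n => μ (P.noiseEvent x ε (2 * κmax) n)) atTop (𝓝 0)) :
    P.L2Consistent μ x ε := by
  obtain ⟨a, b, ha, hb, hab⟩ := hlam
  obtain ⟨K, hK⟩ := hP.bias
  have hκmin := hP.κmin_pos
  have hκmax : 0 < κmax := hκmin.trans_le hP.κmin_le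
  obtain ⟨L, hL⟩ := exists_nat_ge (400 * (2 * κmax) / (9 * (κmin / 2)))
  rw [div_le_iff₀ (by positivity), mul_comm] at hL
  set D := errorConst (κmin / 2) |K| with hD
  have hD0 : 0 ≤ D := by rw [hD, errorConst]; positivity
  refine ⟨D * b ^ 2 + 1, by positivity, ?_⟩
  have hsum := (tendsto_measure_not_wellConditioned hP L).add hnoise
  rw [add_zero] at hsum
  refine tendsto_of_tendsto_of_tendsto_of_le_of_le' tendsto_const_nhds hsum
    (Eventually.of_forall fun _ => zero_le) ?_
  filter_upwards [hab, hK, hP.target_ne_zero, eventually_gt_atTop 0,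
    hP.p_tendsto.eventually_ge_atTop 2] with n hn1 hn2 hn3 hn4 hn5
  -- Monotonicity and subadditivity hold for outer measure, so the failure event need not be
  -- measurable.
  refine (measure_mono ?_).trans (measure_union_le _ _)
  intro ω hω
  by_contra hgood
  rw [Set.mem_union, not_or, Set.notMem_compl_iff, Set.mem_ofPred_eq] at hgood
  obtain ⟨hwell, hbad⟩ := hgood
  rw [Set.mem_ofPred_eq] at hω
  refine hω fun βhat hest => ?_
  have hn0 : (0 : ℝ) < n := by exact_mod_cast hn4
  have hp : (1 : ℝ) < P.p n := by exact_mod_cast hn5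
  have hlogp : 0 < Real.log (P.p n) := Real.log_pos hp
  have hscale : 0 < P.lamScale n := Real.sqrt_pos.2 (by positivity)
  have hlam0 : 0 < P.lam n := lt_of_lt_of_le (by positivity) hn1.1
  have hm := sparsity_pos hP hn3
  have hc : (1 : ℝ) ≤ P.cbar n := by exact_mod_cast (cbar_pos_and_dbar_pos hP hn3).1
  have hε : ∀ k, |1 / (n : ℝ) * ∑ i : Fin n, ε i ω * P.design x n ω i k| ≤ P.lam n / 4 := by
    intro k
    have h1 : ∑ i : Fin n, P.basis n k (x i ω) ^ 2 ≤ n * (2 * κmax) :=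
      hwell.sum_sq_column_le hn4 (Nat.mul_pos (Nat.succ_pos L) hm) k
    have h2 : |∑ i : Fin n, P.basis n k (x i ω) * ε i ω| ≤ n * P.lam n / 4 := by
      by_contra! h3
      exact hbad ⟨k, h1, h3⟩
    rw [abs_mul, abs_of_pos (by positivity : 0 < 1 / (n : ℝ)), one_div_mul_eq_div,
      div_le_iff₀ hn0]
    refine le_trans (le_of_eq ?_) (h2.trans (le_of_eq (by ring)))
    congr 1
    exact Finset.sum_congr rfl fun i _ => mul_comm _ _
  have hmain := error_bound hn4 (P.design x n ω) (P.response x ε n ω) (P.group n)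
    (hP.group_cover n) hlam0 (abs_nonneg K) (half_pos hκmin) (by positivity : 0 < 2 * κmax)
    (P.target n) βhat hest (fun i => P.y (x i ω) - P.lin n (P.target n) (x i ω))
    (fun i => ε i ω)
    (fun i => by
      have : (P.design x n ω *ᵥ P.target n) i = P.lin n (P.target n) (x i ω) := rfl
      rw [this, response]
      ring)
    (fun i => (hn2 _ (hP.input_mem i ω)).trans
      (mul_le_mul_of_nonneg_right (le_abs_self K) hlam0.le))
    hε (m := P.sparsity n) (L := L) rfl hm (by linarith)
    (fun z hz => (hwell z hz).1) (fun z hz => (hwell z hz).2)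
  have hlamsq : P.lam n ^ 2 ≤ b ^ 2 * (Real.log (P.p n) / n) := by
    calc P.lam n ^ 2 ≤ (b * P.lamScale n) ^ 2 := by gcongr; exact hn1.2
      _ = _ := by rw [mul_pow, lamScale, Real.sq_sqrt (by positivity)]
  calc ∑ k, (βhat k - P.target n k) ^ 2 ≤ D * (P.sparsity n * P.lam n ^ 2) := hmain
    _ ≤ D * (((P.cbar n : ℝ) ^ 2 * P.s n * P.dbar n) * (b ^ 2 * (Real.log (P.p n) / n))) := by
        gcongr
        rw [sparsity]
        push_cast
        calc (P.s n : ℝ) * P.cbar n * P.dbar n = P.cbar n * P.s n * P.dbar n := by ring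
          _ ≤ _ := by
            gcongr
            exact le_self_pow₀ hc two_ne_zero
    _ = D * b ^ 2 * ((P.cbar n : ℝ) ^ 2 * P.s n * P.dbar n * Real.log (P.p n) / n) := by ring
    _ ≤ _ := by
        gcongr
        linarith

/-- Sub-Gaussian noise is dominated by a sufficiently large penalty. -/
lemma tendsto_measure_noiseEvent [IsProbabilityMeasure μ] (hP : P.Assumptions μ x κmin κmax)
    {ε : ℕ → S → ℝ} {K : ℝ} (hK : 0 < K) (hε : SubGaussianNoise μ ε K)
    (hind : IndepFun (fun ω i => x i ω) (fun ω i => ε i ω) μ)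
    (hlam : ∀ᶠ n in atTop, √(1536 * (κmax * K)) * P.lamScale n ≤ P.lam n) :
    Tendsto (fun n => μ (P.noiseEvent x ε (2 * κmax) n)) atTop (𝓝 0) := by
  have hκmax : 0 < κmax := hP.κmin_pos.trans_le hP.κmin_le
  have hsub : ∀ i, HasSubgaussianMGF (ε i) (12 * K).toNNReal μ := fun i =>
    (hasSubgaussianMGF_of_tail hK (hε.measurable 0) hε.tail hε.mean_zero).congr_identDistrib
      (hε.identDistrib i).symm
  have hlim : Tendsto (fun n => ENNReal.ofReal (2 / P.p n)) atTop (𝓝 0) := by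
    rw [← ENNReal.ofReal_zero]
    exact ENNReal.tendsto_ofReal
      ((tendsto_natCast_atTop_atTop.comp hP.p_tendsto).const_div_atTop 2)
  refine tendsto_of_tendsto_of_tendsto_of_le_of_le' tendsto_const_nhds hlim
    (Eventually.of_forall fun _ => zero_le) ?_
  filter_upwards [hlam, eventually_gt_atTop 0, hP.p_tendsto.eventually_ge_atTop 2]
    with n hn1 hn2 hn3
  have hn0 : (0 : ℝ) < n := by exact_mod_cast hn2
  have hp : (1 : ℝ) < P.p n := by exact_mod_cast hn3
  have hp0 : (0 : ℝ) < P.p n := by linarith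
  have hlogp : 0 < Real.log (P.p n) := Real.log_pos hp
  have hlam0 : 0 ≤ P.lam n :=
    le_trans (mul_nonneg (Real.sqrt_nonneg _) (Real.sqrt_nonneg _)) hn1
  have hlamsq : 1536 * (κmax * K) * (Real.log (P.p n) / n) ≤ P.lam n ^ 2 := by
    calc 1536 * (κmax * K) * (Real.log (P.p n) / n)
        = (√(1536 * (κmax * K)) * P.lamScale n) ^ 2 := by
          rw [mul_pow, lamScale, Real.sq_sqrt (by positivity), Real.sq_sqrt (by positivity)]
      _ ≤ _ := by
          have : 0 ≤ √(1536 * (κmax * K)) * P.lamScale n :=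
            mul_nonneg (Real.sqrt_nonneg _) (Real.sqrt_nonneg _)
          gcongr
  have hone : ∀ k : Fin (P.p n), μ {ω | ∑ i : Fin n, P.basis n k (x i ω) ^ 2 ≤ n * (2 * κmax) ∧
      n * P.lam n / 4 < |∑ i : Fin n, P.basis n k (x i ω) * ε i ω|}
      ≤ ENNReal.ofReal (2 / (P.p n : ℝ) ^ 2) := by
    intro k
    have hφ : Measurable fun (X : ℕ → Fin d → ℝ) (i : Fin n) => P.basis n k (X i) :=
      measurable_pi_lambda _ fun i =>
        (hP.basis_measurable n k).comp (measurable_pi_apply (i : ℕ))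
    have hψ : Measurable fun (E : ℕ → ℝ) (i : Fin n) => E i :=
      measurable_pi_lambda _ fun i => measurable_pi_apply (i : ℕ)
    refine (measure_random_weighted_sum_le (by positivity : 0 ≤ 12 * K)
      (by positivity : 0 ≤ n * (2 * κmax)) hε.measurable hε.indep hsub
      (Z := fun ω (i : Fin n) => P.basis n k (x i ω))
      (measurable_pi_lambda _ fun i => (hP.basis_measurable n k).comp (hP.input_measurable i))
      (hind.comp hφ hψ)
      (by positivity : 0 ≤ n * P.lam n / 4)).trans (ENNReal.ofReal_le_ofReal ?_)
    -- The exponent is −n λ² / (768 κmax K), so the constant 1536 κmax K in the lower bound for λ²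
    -- makes it at most −2 log p. One log p pays for the union bound, the other sends the
    -- probability to zero.
    have hexp : -(n * P.lam n / 4) ^ 2 / (2 * (n * (2 * κmax) * (12 * K)))
        ≤ -(2 * Real.log (P.p n)) := by
      rw [neg_div, neg_le_neg_iff, le_div_iff₀ (by positivity)]
      have h1 := mul_le_mul_of_nonneg_left hlamsq (by positivity : 0 ≤ (n : ℝ) ^ 2 / 16)
      have h2 : (n : ℝ) ^ 2 / 16 * (1536 * (κmax * K) * (Real.log (P.p n) / n))
          = 2 * Real.log (P.p n) * (2 * (n * (2 * κmax) * (12 * K))) := by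
        field_simp
        ring
      rw [h2] at h1
      refine h1.trans (le_of_eq (by ring))
    have hval : Real.exp (-(2 * Real.log (P.p n))) = 1 / (P.p n : ℝ) ^ 2 := by
      rw [Real.exp_neg, two_mul, Real.exp_add, Real.exp_log hp0, ← sq, one_div]
    calc 2 * Real.exp _ ≤ 2 * Real.exp (-(2 * Real.log (P.p n))) := by gcongr
      _ = 2 / (P.p n : ℝ) ^ 2 := by rw [hval]; ring
  rw [noiseEvent, Set.ofPred_exists]
  refine (measure_iUnion_fintype_le μ _).trans ((Finset.sum_le_sum fun k _ => hone k).trans ?_)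
  rw [Finset.sum_const, Finset.card_univ, Fintype.card_fin, ← ENNReal.ofReal_nsmul]
  refine ENNReal.ofReal_le_ofReal (le_of_eq ?_)
  rw [nsmul_eq_mul]
  field_simp

lemma noiseEvent_zero_eq_empty {S : Type*} {x : ℕ → S → Fin d → ℝ} {κ : ℝ} {n : ℕ}
    (h : 0 ≤ P.lam n) :
    P.noiseEvent x (fun _ _ => 0) κ n = ∅ := by
  ext ω
  have : 0 ≤ n * P.lam n / 4 := by positivity
  simp [noiseEvent, this.not_gt]

end Problem

end OverlapLasso

theorem theorem2 :
    -- deterministic case: no noise, arbitrary constants in `λₙ ≍ √(log p / n)`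
    (∀ (S : Type*) [MeasurableSpace S] (μ : Measure S) [IsProbabilityMeasure μ]
      (d : ℕ) (P : OverlapLasso.Problem d) (x : ℕ → S → Fin d → ℝ) (κmin κmax : ℝ),
      P.Assumptions μ x κmin κmax →
      (∃ a b : ℝ, 0 < a ∧ 0 < b ∧ ∀ᶠ n in atTop,
        a * P.lamScale n ≤ P.lam n ∧ P.lam n ≤ b * P.lamScale n) →
      P.L2Consistent μ x (fun _ _ => 0)) ∧
    -- stochastic case: the lower constant in `λₙ ≍ √(log p / n)` dominates the noise level
    (∀ K κmax : ℝ, 0 < K → 0 < κmax → ∃ A : ℝ, 0 < A ∧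
      ∀ (S : Type*) [MeasurableSpace S] (μ : Measure S) [IsProbabilityMeasure μ]
        (d : ℕ) (P : OverlapLasso.Problem d) (x : ℕ → S → Fin d → ℝ) (ε : ℕ → S → ℝ) (κmin : ℝ),
        P.Assumptions μ x κmin κmax →
        OverlapLasso.SubGaussianNoise μ ε K →
        IndepFun (fun ω i => x i ω) (fun ω i => ε i ω) μ →
        (∃ a b : ℝ, A ≤ a ∧ 0 < b ∧ ∀ᶠ n in atTop,
          a * P.lamScale n ≤ P.lam n ∧ P.lam n ≤ b * P.lamScale n) →
        P.L2Consistent μ x ε) := by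
  refine ⟨?_, ?_⟩
  · intro S _ μ _ d P x κmin κmax hP hlam
    refine OverlapLasso.Problem.consistent_of_tendsto_noiseEvent hP hlam ?_
    obtain ⟨a, b, ha, -, hab⟩ := hlam
    refine tendsto_const_nhds.congr' ?_
    filter_upwards [hab] with n hn
    rw [OverlapLasso.Problem.noiseEvent_zero_eq_empty
      (le_trans (mul_nonneg ha.le (Real.sqrt_nonneg _)) hn.1), measure_empty]
  · intro K κmax hK hκmax
    refine ⟨√(1536 * (κmax * K)), Real.sqrt_pos.2 (by positivity), ?_⟩
    intro S _ μ _ d P x ε κmin hP hε hind hlam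
    obtain ⟨a, b, ha, hb, hab⟩ := hlam
    refine OverlapLasso.Problem.consistent_of_tendsto_noiseEvent hP
      ⟨a, b, lt_of_lt_of_le (Real.sqrt_pos.2 (by positivity)) ha, hb, hab⟩ ?_
    refine OverlapLasso.Problem.tendsto_measure_noiseEvent hP hK hε hind ?_
    filter_upwards [hab] with n hn
    exact le_trans (mul_le_mul_of_nonneg_right ha (Real.sqrt_nonneg _)) hn.1
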